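/- For a number field $K$ with ring of integers $\mathcal{O}_K$, a prime $\ell$ and an integer $f\ge 1$, the Ostrowski ideal of $K$ at $\ell^f$ is the product of all maximal ideals of $\mathcal{O}_K$ of norm $\ell^f$ (the unit ideal if there are none). $K$ is called a Pólya field if all its Ostrowski ideals are principal. Below, $\left(\frac{a}{\ell}\right)$ denotes the Legendre symbol. **Theorem.** Let $p,q,r,s$ be prime numbers with $p\equiv q\equiv r\equiv 3 \pmod 4$ and $qrs\equiv 1\pmod 4$, and suppose that $\left(\frac{q}{s}\right)=\left(\frac{r}{s}\right)=1$ does not hold. Then the bi-quadratic field $\mathbb{Q}(\sqrt{2p},\sqrt{qrs})$ is a Pólya field in each of the following cases. (i) $\left(\frac{q}{s}\right)=\left(\frac{r}{s}\right)=-1$ and one of the following holds: - C1: $\left(\frac{2p}{s}\right)=\left(\frac{qr}{p}\right)=-1$, $\left(\frac{2p}{q}\right)=1$, and $q\not\equiv r\pmod 8$. - C2: $\left(\frac{s}{p}\right)=1$, $\left(\frac{qr}{p}\right)=-1$, $p\equiv q\equiv r\pmod 8$, and $s\equiv 5\pmod 8$. - C3: $\left(\frac{s}{p}\right)=\left(\frac{qr}{p}\right)=-1$,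 $p\not\equiv q\pmod 8$, $q\equiv r\pmod 8$, and $s\equiv 1\pmod 8$. (ii) $\left(\frac{q}{s}\right)\neq\left(\frac{r}{s}\right)=1$ and one of the following holds: - C4: $\left(\frac{r}{p}\right)=\left(\frac{p}{q}\right)=\left(\frac{q}{r}\right)=-1$, and either [$\left(\frac{2}{p}\right)=\left(\frac{2}{r}\right)=\left(\frac{2}{s}\right)=-1$ and $\left(\frac{s}{p}\right)=1$] or [$\left(\frac{2}{p}\right)=\left(\frac{2}{q}\right)=-\left(\frac{2}{r}\right)=\left(\frac{2}{s}\right)=1$ and $\left(\frac{s}{p}\right)=-1$]. - C5: $\left(\frac{r}{p}\right)=\left(\frac{p}{q}\right)=\left(\frac{r}{q}\right)=-1$, and either [$\left(\frac{2}{p}\right)=-\left(\frac{2}{r}\right)=-\left(\frac{2}{s}\right)=1$ and $\left(\frac{s}{p}\right)=1$] or [$\left(\frac{2}{p}\right)\neq\left(\frac{2}{q}\right)$, $\left(\frac{2}{r}\right)=-1$, $\left(\frac{2}{s}\right)=1$ and $\left(\frac{s}{p}\right)=-1$]. - C6: $\left(\frac{p}{r}\right)=\left(\frac{q}{p}\right)=\left(\frac{r}{q}\right)=-1$,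 and either [$\left(\frac{2}{p}\right)=\left(\frac{2}{r}\right)=-\left(\frac{2}{s}\right)=1$ and $\left(\frac{s}{p}\right)=1$] or [$\left(\frac{2}{p}\right)=\left(\frac{2}{q}\right)=-\left(\frac{2}{r}\right)=-\left(\frac{2}{s}\right)=-1$ and $\left(\frac{s}{p}\right)=-1$]. - C7: $\left(\frac{p}{r}\right)=\left(\frac{q}{p}\right)=\left(\frac{q}{r}\right)=-1$, and either [$\left(\frac{2}{p}\right)=-\left(\frac{2}{r}\right)=\left(\frac{2}{s}\right)=-1$ and $\left(\frac{s}{p}\right)=1$] or [$\left(\frac{2}{p}\right)\neq\left(\frac{2}{q}\right)$, $\left(\frac{2}{r}\right)=\left(\frac{2}{s}\right)=1$ and $\left(\frac{s}{p}\right)=-1$]. -/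

import Mathlib

/-- The set of maximal ideals of the ring of integers of `K` of absolute norm `n`. -/
def maximalIdealsOfNorm (K : Type*) [Field K] [NumberField K] (n : ℕ) :
    Set (Ideal (NumberField.RingOfIntegers K)) :=
  {I | I.IsMaximal ∧ Ideal.absNorm I = n}

theorem maximalIdealsOfNorm_finite (K : Type*) [Field K] [NumberField K] (n : ℕ) :
    (maximalIdealsOfNorm K n).Finite := by
  rcases Nat.eq_zero_or_pos n with rfl | hn
  · refine (Set.finite_singleton (⊥ : Ideal (NumberField.RingOfIntegers K))).subset ?_
    rintro I ⟨-, hI⟩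
    exact Ideal.absNorm_eq_zero_iff.mp hI
  · exact (Ideal.finite_setOfPred_absNorm_eq n).subset fun I hI => hI.2

/-- The Ostrowski ideal of `K` at `n` (of interest when `n` is a prime power): the product of all
maximal ideals of the ring of integers of `K` of absolute norm `n`. -/
noncomputable def ostrowskiIdeal (K : Type*) [Field K] [NumberField K] (n : ℕ) :
    Ideal (NumberField.RingOfIntegers K) :=
  ∏ I ∈ (maximalIdealsOfNorm_finite K n).toFinset, I

/-- A number field is a Pólya field if its Ostrowski ideals at all prime powers
`p ^ f`, `f ≥ 1`, are principal. -/
def IsPolyaField (K : Type*) [Field K] [NumberField K] : Prop :=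
  ∀ p f : ℕ, p.Prime → 1 ≤ f → (ostrowskiIdeal K (p ^ f)).IsPrincipal

/-- The field `ℚ(√a, √b)`, as a subfield of `ℝ`. -/
noncomputable abbrev realBiquadraticField (a b : ℕ) : IntermediateField ℚ ℝ :=
  IntermediateField.adjoin ℚ {Real.sqrt a, Real.sqrt b}

theorem isIntegral_sqrt_natCast (a : ℕ) : IsIntegral ℚ (Real.sqrt a) := by
  refine IsIntegral.of_pow (n := 2) two_pos ?_
  rw [Real.sq_sqrt (Nat.cast_nonneg a)]
  simpa using isIntegral_algebraMap (R := ℚ) (A := ℝ) (x := (a : ℚ))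

instance realBiquadraticField_numberField (a b : ℕ) :
    NumberField (realBiquadraticField a b) where
  to_charZero := inferInstance
  to_finiteDimensional := by
    apply IntermediateField.finiteDimensional_adjoin
    rintro x (rfl | rfl)
    · exact isIntegral_sqrt_natCast a
    · exact isIntegral_sqrt_natCast b

/-! The field $K=\mathbb{Q}(\sqrt{2p},\sqrt{qrs})$ is Galois over $\mathbb{Q}$, so every nontrivial
Ostrowski ideal at a power of $\ell$ is the product of all primes above $\ell$, that is, the radical
of $(\ell)$. The ramified primes are $2,p,q,r,s$, each with ramification index 2. Hence it is enough
that each of them is, up to a unit of $\mathcal{O}_K$, the square of some $\pi$: the radical is then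
$(\pi)$ (`radical_span_of_dvd_left`, `radical_span_of_dvd_right`, `radical_span_two`).

Such squares come from Pell equations. For $N=2p$, $qrs$ and $2pqrs$, whose square roots lie in $K$,
write the fundamental solution as $x=2u+1$, $y=2v$. Then $u(u+1)=Nv^2$ splits as $u+1=da^2$,
$u=d'b^2$ with $dd'=N$, and minimality gives $d\neq 1$ (`exists_mul_sq_eq_mul_sq_add_one`). Since
$(da+b\sqrt N)^2=d(x+y\sqrt N)$ and $x+y\sqrt N$ is a unit, $d$ is a square up to a unit
(`isSquareUpToUnit_of_splitting`).

Reducing $da^2-d'b^2=1$ modulo each odd prime divisor of $N$ restricts $d$ through Legendre symbols.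
For $N=2p$ this yields $2$ and $p$. For $qrs$ it yields $s$ if $(r/s)=-1$, and $r$ if $(r/s)=1$. For
$2pqrs$, the conditions C1–C7 are what forces $d$ to separate the two remaining primes
(`selection_of_five_factors`). Squares up to units are closed under quotients, so all five primes
are obtained. -/

/-! ### Splitting the Pell equation -/

section PellDecomposition

/-- Since $A$ and $B$ are coprime, $\gcd(N,A)\gcd(N,B)=N$. The cofactors are coprime with product
$v^2$, so each is a square. -/
theorem Nat.Coprime.exists_eq_mul_sq_of_mul_eq_mul_sq {A B N v : ℕ} (hAB : A.Coprime B)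
    (h : A * B = N * v ^ 2) (hN : N ≠ 0) :
    ∃ d d' a b : ℕ, d * d' = N ∧ A = d * a ^ 2 ∧ B = d' * b ^ 2 := by
  have hN' : N.gcd A * N.gcd B = N := by
    rw [← hAB.gcd_mul]
    exact Nat.gcd_eq_left (Dvd.intro _ h.symm)
  obtain ⟨A', hA⟩ := Nat.gcd_dvd_right N A
  obtain ⟨B', hB⟩ := Nat.gcd_dvd_right N B
  have hsq : A' * B' = v ^ 2 := by
    refine Nat.eq_of_mul_eq_mul_left (Nat.pos_of_ne_zero hN) ?_
    rw [← h]
    calc N * (A' * B') = (N.gcd A * N.gcd B) * (A' * B') := by rw [hN']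
      _ = (N.gcd A * A') * (N.gcd B * B') := by ring
      _ = A * B := by rw [← hA, ← hB]
  have hco : A'.Coprime B' :=
    (hAB.coprime_dvd_left (Dvd.intro_left _ hA.symm)).coprime_dvd_right
      (Dvd.intro_left _ hB.symm)
  obtain ⟨a, ha⟩ := exists_eq_pow_of_mul_eq_pow (Nat.isUnit_iff.mpr hco) hsq
  obtain ⟨b, hb⟩ := exists_eq_pow_of_mul_eq_pow (Nat.isUnit_iff.mpr hco.symm)
    ((mul_comm _ _).trans hsq)
  exact ⟨_, _, a, b, hN', ha ▸ hA, hb ▸ hB⟩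

/-- A nontrivial splitting of the Pell equation of a nonsquare `N`, obtained from the fundamental
solution. -/
theorem exists_mul_sq_eq_mul_sq_add_one {N : ℕ} (hN : ¬ IsSquare N)
    (hmod : N % 4 = 1 ∨ N % 4 = 2) :
    ∃ d d' a b : ℕ, d * d' = N ∧ d ≠ 1 ∧ d * a ^ 2 = d' * b ^ 2 + 1 := by
  have hN0 : N ≠ 0 := by rintro rfl; simp at hN
  have hNZ : ¬ IsSquare (N : ℤ) := by rwa [Int.isSquare_natCast_iff]
  obtain ⟨e, he⟩ := Pell.IsFundamental.exists_of_not_isSquare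
    (by exact_mod_cast Nat.pos_of_ne_zero hN0) hNZ
  obtain ⟨x, hx⟩ := Int.eq_ofNat_of_zero_le he.x_pos.le
  obtain ⟨y, hy⟩ := Int.eq_ofNat_of_zero_le he.2.1.le
  have hx1 : 1 < x := by have := he.1; rw [hx] at this; exact_mod_cast this
  have hy0 : 0 < y := by have := he.2.1; rw [hy] at this; exact_mod_cast this
  have hprop : x ^ 2 = N * y ^ 2 + 1 := by
    have := e.prop
    rw [hx, hy] at this
    zify
    linarith
  -- This is where the residue of $N$ modulo 4 matters: for $N\equiv 3$ an even $x$ with odd $y$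
  -- would also be possible.
  have hodd : x % 2 = 1 ∧ y % 2 = 0 := by
    have h1 : (x % 4) ^ 2 % 4 = ((N % 4) * ((y % 4) ^ 2 % 4) + 1) % 4 := by
      rw [← Nat.pow_mod, ← Nat.pow_mod, hprop, Nat.add_mod, Nat.mul_mod, ← Nat.add_mod_left,
        Nat.mul_mod (N % 4), Nat.mod_mod, Nat.mod_mod]
      omega
    have hx4 : x % 4 < 4 := Nat.mod_lt _ (by norm_num)
    have hy4 : y % 4 < 4 := Nat.mod_lt _ (by norm_num)
    rw [← Nat.mod_mod_of_dvd x (show 2 ∣ 4 by norm_num),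
      ← Nat.mod_mod_of_dvd y (show 2 ∣ 4 by norm_num)]
    generalize x % 4 = x' at *
    generalize y % 4 = y' at *
    rcases hmod with h | h <;> rw [h] at h1 <;> interval_cases x' <;> interval_cases y' <;>
      simp_all
  obtain ⟨u, rfl⟩ : ∃ u, x = 2 * u + 1 := ⟨x / 2, by omega⟩
  obtain ⟨v, rfl⟩ : ∃ v, y = 2 * v := ⟨y / 2, by omega⟩
  have huv : (u + 1) * u = N * v ^ 2 := by nlinarith
  obtain ⟨d, d', a, b, hd, hA, hB⟩ :=
    Nat.Coprime.exists_eq_mul_sq_of_mul_eq_mul_sq (by simp) huv hN0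
  refine ⟨d, d', a, b, hd, ?_, by rw [← hA, ← hB]⟩
  -- If $d=1$, then $(a,b)$ itself solves the Pell equation with $1<a$, although the fundamental
  -- $x=2a^2-1$ exceeds $a$.
  rintro rfl
  rw [one_mul] at hd hA
  subst hd
  have hsol : (a : ℤ) ^ 2 - d' * (b : ℤ) ^ 2 = 1 := by
    have : a ^ 2 = d' * b ^ 2 + 1 := by rw [← hA, ← hB]
    zify at this
    linarith
  have ha : 1 < a := by
    by_contra! h
    have : a ^ 2 ≤ 1 := by nlinarith
    omega
  have hle := he.x_le_x (a := Pell.Solution₁.mk a b hsol) (by simpa using ha)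
  rw [hx, Pell.Solution₁.x_mk] at hle
  have hle' : 2 * u + 1 ≤ a := by exact_mod_cast hle
  nlinarith

end PellDecomposition

/-! ### Residue conditions imposed by a splitting -/

section Legendre

variable {ℓ : ℕ} [Fact ℓ.Prime] {d d' a b : ℕ}

theorem legendreSym_eq_one_of_dvd_right (h : d * a ^ 2 = d' * b ^ 2 + 1) (hl : ℓ ∣ d') :
    legendreSym ℓ d = 1 := by
  have h1 : (d : ZMod ℓ) * a ^ 2 = 1 := by
    have := congrArg (Nat.cast (R := ZMod ℓ)) h
    push_cast at this
    rw [(ZMod.natCast_eq_zero_iff d' ℓ).mpr hl] at this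
    simpa using this
  have hd : (d : ZMod ℓ) ≠ 0 := by rintro h0; simp [h0] at h1
  have ha : (a : ZMod ℓ) ≠ 0 := by rintro h0; simp [h0] at h1
  rw [legendreSym.eq_one_iff' ℓ hd]
  refine ⟨(a : ZMod ℓ)⁻¹, ?_⟩
  field_simp
  exact h1

/-- Modulo $\ell$ the equation reads $-d'b^2=1$, so $-d'$ is a square. -/
theorem legendreSym_eq_one_of_dvd_left (h : d * a ^ 2 = d' * b ^ 2 + 1) (hl : ℓ ∣ d) :
    legendreSym ℓ (-1) * legendreSym ℓ d' = 1 := by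
  have h1 : (-1 * d' : ZMod ℓ) * b ^ 2 = 1 := by
    have := congrArg (Nat.cast (R := ZMod ℓ)) h
    push_cast at this
    rw [(ZMod.natCast_eq_zero_iff d ℓ).mpr hl] at this
    linear_combination this
  have hd : ((-1 * d' : ℤ) : ZMod ℓ) ≠ 0 := by
    push_cast; intro h0; rw [h0, zero_mul] at h1; exact zero_ne_one h1
  have hb : (b : ZMod ℓ) ≠ 0 := by rintro h0; simp [h0] at h1
  rw [← legendreSym.mul, legendreSym.eq_one_iff ℓ hd]
  refine ⟨(b : ZMod ℓ)⁻¹, ?_⟩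
  push_cast
  field_simp
  linear_combination h1

end Legendre

/-! ### Legendre symbols and divisors encoded as Booleans -/

section Signs

/-- The sign `-1` for `true` and `1` for `false`. -/
def boolSign (e : Bool) : ℤ := bif e then -1 else 1

/-- The factor `n` if it is selected, and `1` otherwise. -/
def selectFactor (x : Bool) (n : ℕ) : ℕ := bif x then n else 1

theorem boolSign_eq_one {e : Bool} : boolSign e = 1 ↔ e = false := by cases e <;> decide

theorem boolSign_eq_neg_one {e : Bool} : boolSign e = -1 ↔ e = true := by cases e <;> decide

theorem boolSign_inj {e f : Bool} : boolSign e = boolSign f ↔ e = f := by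
  cases e <;> cases f <;> decide

theorem boolSign_mul (e f : Bool) : boolSign e * boolSign f = boolSign (e ^^ f) := by
  cases e <;> cases f <;> decide

theorem neg_boolSign (e : Bool) : -boolSign e = boolSign !e := by cases e <;> decide

/-- Iterating this along the prime factors of $N$ turns a factorization $dd'=N$ into one Boolean per
prime, `true` meaning that the prime divides $d$. -/
theorem exists_selectFactor {ℓ M d d' : ℕ} (hl : ℓ.Prime) (h : d * d' = ℓ * M) :
    ∃ x e e', d = selectFactor x ℓ * e ∧ d' = selectFactor (!x) ℓ * e' ∧ e * e' = M := by
  rcases hl.dvd_mul.mp (Dvd.intro M h.symm) with ⟨e, rfl⟩ | ⟨e, rfl⟩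
  · refine ⟨true, e, d', by simp [selectFactor], by simp [selectFactor], ?_⟩
    exact Nat.eq_of_mul_eq_mul_left hl.pos (by rw [← h]; ring)
  · refine ⟨false, d, e, by simp [selectFactor], by simp [selectFactor], ?_⟩
    exact Nat.eq_of_mul_eq_mul_left hl.pos (by rw [← h]; ring)

theorem exists_legendreSym_eq_boolSign {p n : ℕ} [Fact p.Prime] (h : ¬ p ∣ n) :
    ∃ e, legendreSym p n = boolSign e := by
  rcases legendreSym.eq_one_or_neg_one p (a := n)
    (by simpa [ZMod.natCast_eq_zero_iff] using h) with h | h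
  · exact ⟨false, h⟩
  · exact ⟨true, h⟩

theorem legendreSym_selectFactor {p n : ℕ} [Fact p.Prime] {e : Bool}
    (h : legendreSym p n = boolSign e) (x : Bool) :
    legendreSym p (selectFactor x n) = boolSign (x && e) := by
  cases x
  · simp [selectFactor, boolSign, legendreSym.at_one]
  · simpa [selectFactor] using h

theorem legendreSym_neg_one_of_mod_four_eq_three {p : ℕ} [Fact p.Prime] (hp : p % 4 = 3) :
    legendreSym p (-1) = boolSign true := by
  rw [legendreSym.at_neg_one (by rintro rfl; omega), ZMod.χ₄_nat_three_mod_four hp]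
  rfl

theorem legendreSym_neg_one_of_mod_four_eq_one {p : ℕ} [Fact p.Prime] (hp : p % 4 = 1) :
    legendreSym p (-1) = boolSign false := by
  rw [legendreSym.at_neg_one (by rintro rfl; omega), ZMod.χ₄_nat_one_mod_four hp]
  rfl

theorem exists_legendreSym_two_of_mod_four_eq_three {p : ℕ} [Fact p.Prime] (hp : p % 4 = 3) :
    ∃ e, legendreSym p 2 = boolSign e ∧ (e = true ↔ p % 8 = 3) := by
  rw [legendreSym.at_two (by rintro rfl; omega), ZMod.χ₈_nat_eq_if_mod_eight]
  rcases (by omega : p % 8 = 3 ∨ p % 8 = 7) with h | h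
  · exact ⟨true, by simp [h, boolSign]; omega, by simp [h]⟩
  · exact ⟨false, by simp [h, boolSign]; omega, by simp [h]⟩

theorem exists_legendreSym_two_of_mod_four_eq_one {p : ℕ} [Fact p.Prime] (hp : p % 4 = 1) :
    ∃ e, legendreSym p 2 = boolSign e ∧ (e = true ↔ p % 8 = 5) := by
  rw [legendreSym.at_two (by rintro rfl; omega), ZMod.χ₈_nat_eq_if_mod_eight]
  rcases (by omega : p % 8 = 5 ∨ p % 8 = 1) with h | h
  · exact ⟨true, by simp [h, boolSign]; omega, by simp [h]⟩
  · exact ⟨false, by simp [h, boolSign]; omega, by simp [h]⟩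

end Signs

/-! ### Finite checks over the possible divisors -/

section Combinatorics

set_option maxRecDepth 100000 in
set_option synthInstance.maxSize 100000 in
set_option synthInstance.maxHeartbeats 400000 in
-- Products of signs become exclusive ors, and `qr` stands for $(r/q)$, so `!qr` is $(q/r)$ by
-- reciprocity. The leading `true` in the conditions at a selected $q$ or $r$ is $(-1/q)=(-1/r)=-1$;
-- it is absent at $s\equiv 1 \pmod 4$. The conclusion says that $d$ is $qr$ or $s$ if $(r/s)=-1$,
-- and $qs$ or $r$ otherwise.
theorem selection_of_three_factors : ∀ qs rs : Bool, qs = true → ∀ qr xq xr xs : Bool,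
    ¬ (xq = false ∧ xr = false ∧ xs = false) →
    (xq = false → ((xr && qr) ^^ (xs && qs)) = false) →
    (xr = false → ((xq && !qr) ^^ (xs && rs)) = false) →
    (xs = false → ((xq && qs) ^^ (xr && rs)) = false) →
    (xq = true → (true ^^ (!xr && qr) ^^ (!xs && qs)) = false) →
    (xr = true → (true ^^ (!xq && !qr) ^^ (!xs && rs)) = false) →
    (xs = true → ((!xq && qs) ^^ (!xr && rs)) = false) →
    (rs = true → xq = xr ∧ xs ≠ xq) ∧ (rs = false → xq = xs ∧ xr ≠ xq) := by
  decide

set_option maxRecDepth 100000 in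
set_option synthInstance.maxSize 100000 in
set_option synthInstance.maxHeartbeats 400000 in
-- The first hypothesis is C1–C7 in Boolean form. The conclusion ignores the factors 2 and $p$,
-- already known to be squares up to units, and the one of $r$, $s$ obtained from $qrs$; it only
-- asks that $d$ contain exactly one of the other two primes.
theorem selection_of_five_factors : ∀ qs rs p2 q2 r2 s2 ps pq pr qr : Bool,
    ((qs = true ∧ rs = true) ∧
      (((s2 ^^ ps) = true ∧ (pq ^^ pr) = true ∧ (q2 ^^ !pq) = false ∧ q2 ≠ r2) ∨
        (ps = false ∧ (pq ^^ pr) = true ∧ p2 = q2 ∧ q2 = r2 ∧ s2 = true) ∨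
        (ps = true ∧ (pq ^^ pr) = true ∧ p2 ≠ q2 ∧ q2 = r2 ∧ s2 = false))) ∨
    ((qs ≠ rs ∧ rs = false) ∧
      (((pr = true ∧ (!pq) = true ∧ (!qr) = true) ∧
          ((p2 = true ∧ r2 = true ∧ s2 = true ∧ ps = false) ∨
            (p2 = false ∧ q2 = false ∧ r2 = true ∧ s2 = false ∧ ps = true))) ∨
        ((pr = true ∧ (!pq) = true ∧ qr = true) ∧
          ((p2 = false ∧ r2 = true ∧ s2 = true ∧ ps = false) ∨
            (p2 ≠ q2 ∧ r2 = true ∧ s2 = false ∧ ps = true))) ∨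
        (((!pr) = true ∧ pq = true ∧ qr = true) ∧
          ((p2 = false ∧ r2 = false ∧ s2 = true ∧ ps = false) ∨
            (p2 = true ∧ q2 = true ∧ r2 = false ∧ s2 = false ∧ ps = true))) ∨
        (((!pr) = true ∧ pq = true ∧ (!qr) = true) ∧
          ((p2 = true ∧ r2 = false ∧ s2 = true ∧ ps = false) ∨
            (p2 ≠ q2 ∧ r2 = false ∧ s2 = false ∧ ps = true))))) →
    ∀ x2 xp xq xr xs : Bool,
    ¬ (x2 = false ∧ xp = false ∧ xq = false ∧ xr = false ∧ xs = false) →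
    (xp = false → ((x2 && p2) ^^ (xq && pq) ^^ (xr && pr) ^^ (xs && ps)) = false) →
    (xq = false → ((x2 && q2) ^^ (xp && !pq) ^^ (xr && qr) ^^ (xs && qs)) = false) →
    (xr = false → ((x2 && r2) ^^ (xp && !pr) ^^ (xq && !qr) ^^ (xs && rs)) = false) →
    (xs = false → ((x2 && s2) ^^ (xp && ps) ^^ (xq && qs) ^^ (xr && rs)) = false) →
    (xp = true → (true ^^ (!x2 && p2) ^^ (!xq && pq) ^^ (!xr && pr) ^^ (!xs && ps)) = false) →
    (xq = true → (true ^^ (!x2 && q2) ^^ (!xp && !pq) ^^ (!xr && qr) ^^ (!xs && qs)) = false) →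
    (xr = true → (true ^^ (!x2 && r2) ^^ (!xp && !pr) ^^ (!xq && !qr) ^^ (!xs && rs)) = false) →
    (xs = true → ((!x2 && s2) ^^ (!xp && ps) ^^ (!xq && qs) ^^ (!xr && rs)) = false) →
    (rs = true → xq ≠ xr) ∧ (rs = false → xq ≠ xs) := by
  decide +kernel

end Combinatorics

/-! ### The splittings for $qrs$ and $2pqrs$ -/

section Splittings

theorem ne_of_legendreSym_eq_neg_one {a b : ℕ} [Fact a.Prime] (h : legendreSym a b = -1) :
    a ≠ b := by
  rintro rfl
  rw [(legendreSym.eq_zero_iff a a).mpr (by simp)] at h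
  norm_num at h

theorem legendreSym_selectFactor_false {p : ℕ} [Fact p.Prime] (n : ℕ) :
    legendreSym p (selectFactor false n) = 1 := legendreSym.at_one p

theorem Nat.Prime.not_isSquare_mul_of_not_dvd {q M : ℕ} (hq : q.Prime) (h : ¬ q ∣ M) :
    ¬ IsSquare (q * M) := by
  rintro ⟨c, hc⟩
  have hqc : q ∣ c := by
    have : q ∣ c * c := Dvd.intro _ hc
    simpa [hq.dvd_mul] using this
  obtain ⟨k, rfl⟩ := hqc
  exact h ⟨k * k, Nat.eq_of_mul_eq_mul_left hq.pos (by rw [hc]; ring)⟩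

theorem Nat.Prime.not_dvd_prime_mul {q a M : ℕ} (hq : q.Prime) (ha : a.Prime) (hqa : q ≠ a)
    (h : ¬ q ∣ M) : ¬ q ∣ a * M := by
  rw [hq.dvd_mul, Nat.prime_dvd_prime_iff_eq hq ha]
  tauto

variable {p q r s : ℕ} [Fact p.Prime] [Fact q.Prime] [Fact r.Prime] [Fact s.Prime]

theorem exists_splitting_of_three_primes (hq : q % 4 = 3) (hr : r % 4 = 3) (hs : s % 4 = 1)
    (hqr' : q ≠ r) {qs rs qr : Bool}
    (hqs : legendreSym q s = boolSign qs) (hsq : legendreSym s q = boolSign qs)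
    (hrs : legendreSym r s = boolSign rs) (hsr : legendreSym s r = boolSign rs)
    (hqr : legendreSym q r = boolSign qr) (hrq : legendreSym r q = boolSign !qr)
    (hqs' : qs = true) :
    ∃ (xq xr xs : Bool) (d' a b : ℕ),
      selectFactor xq q * (selectFactor xr r * selectFactor xs s) * d' = q * r * s ∧
      selectFactor xq q * (selectFactor xr r * selectFactor xs s) * a ^ 2 = d' * b ^ 2 + 1 ∧
      (rs = true → xq = xr ∧ xs ≠ xq) ∧ (rs = false → xq = xs ∧ xr ≠ xq) := by
  have hqP : q.Prime := Fact.out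
  have hrP : r.Prime := Fact.out
  have hsP : s.Prime := Fact.out
  -- The trailing factor 1 makes the peeling of primes end with two cofactors of product 1.
  have hns : ¬ IsSquare (q * (r * (s * 1))) := by
    refine hqP.not_isSquare_mul_of_not_dvd (hqP.not_dvd_prime_mul hrP hqr'
      (hqP.not_dvd_prime_mul hsP (by rintro rfl; omega) hqP.not_dvd_one))
  have hmod : (q * (r * (s * 1))) % 4 = 1 := by
    simp [Nat.mul_mod, hq, hr, hs]
  obtain ⟨d, d', a, b, hdd, hd1, heq⟩ := exists_mul_sq_eq_mul_sq_add_one hns (Or.inl hmod)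
  obtain ⟨xq, d, d', rfl, rfl, hdd₁⟩ := exists_selectFactor hqP hdd
  obtain ⟨xr, d, d', rfl, rfl, hdd₂⟩ := exists_selectFactor hrP hdd₁
  obtain ⟨xs, d, d', rfl, rfl, hdd₃⟩ := exists_selectFactor hsP hdd₂
  obtain ⟨rfl, rfl⟩ := mul_eq_one.mp hdd₃
  simp only [mul_one] at heq hd1
  refine ⟨xq, xr, xs, _, a, b, ?_, heq,
    selection_of_three_factors qs rs hqs' qr xq xr xs ?_ ?_ ?_ ?_ ?_ ?_ ?_⟩
  · cases xq <;> cases xr <;> cases xs <;> simp [selectFactor] <;> ring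
  · rintro ⟨rfl, rfl, rfl⟩
    exact hd1 rfl
  · rintro rfl
    have := legendreSym_eq_one_of_dvd_right (ℓ := q) heq (dvd_mul_right _ _)
    rw [Nat.cast_mul, Nat.cast_mul, legendreSym.mul, legendreSym.mul,
      legendreSym_selectFactor hqr, legendreSym_selectFactor hqs] at this
    simpa only [Bool.not_true, legendreSym_selectFactor_false, one_mul, mul_one, boolSign_mul,
      boolSign_eq_one, Bool.xor_assoc, Bool.false_xor] using this
  · rintro rfl
    have := legendreSym_eq_one_of_dvd_right (ℓ := r) heq
      ((dvd_mul_right _ _).trans (dvd_mul_left _ _))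
    rw [Nat.cast_mul, Nat.cast_mul, legendreSym.mul, legendreSym.mul,
      legendreSym_selectFactor hrq, legendreSym_selectFactor hrs] at this
    simpa only [Bool.not_true, legendreSym_selectFactor_false, one_mul, mul_one, boolSign_mul,
      boolSign_eq_one, Bool.xor_assoc, Bool.false_xor] using this
  · rintro rfl
    have := legendreSym_eq_one_of_dvd_right (ℓ := s) heq
      ((dvd_mul_left _ _).trans (dvd_mul_left _ _))
    rw [Nat.cast_mul, Nat.cast_mul, legendreSym.mul, legendreSym.mul,
      legendreSym_selectFactor hsq, legendreSym_selectFactor hsr] at this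
    simpa only [Bool.not_true, legendreSym_selectFactor_false, one_mul, mul_one, boolSign_mul,
      boolSign_eq_one, Bool.xor_assoc, Bool.false_xor] using this
  · rintro rfl
    have := legendreSym_eq_one_of_dvd_left (ℓ := q) heq (dvd_mul_right _ _)
    rw [legendreSym_neg_one_of_mod_four_eq_three hq, Nat.cast_mul, Nat.cast_mul, legendreSym.mul,
      legendreSym.mul, legendreSym_selectFactor hqr, legendreSym_selectFactor hqs] at this
    simpa only [Bool.not_true, legendreSym_selectFactor_false, one_mul, mul_one, boolSign_mul,
      boolSign_eq_one, Bool.xor_assoc, Bool.false_xor] using this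
  · rintro rfl
    have := legendreSym_eq_one_of_dvd_left (ℓ := r) heq
      ((dvd_mul_right _ _).trans (dvd_mul_left _ _))
    rw [legendreSym_neg_one_of_mod_four_eq_three hr, Nat.cast_mul, Nat.cast_mul, legendreSym.mul,
      legendreSym.mul, legendreSym_selectFactor hrq, legendreSym_selectFactor hrs] at this
    simpa only [Bool.not_true, legendreSym_selectFactor_false, one_mul, mul_one, boolSign_mul,
      boolSign_eq_one, Bool.xor_assoc, Bool.false_xor] using this
  · rintro rfl
    have := legendreSym_eq_one_of_dvd_left (ℓ := s) heq
      ((dvd_mul_left _ _).trans (dvd_mul_left _ _))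
    rw [legendreSym_neg_one_of_mod_four_eq_one hs, Nat.cast_mul, Nat.cast_mul, legendreSym.mul,
      legendreSym.mul, legendreSym_selectFactor hsq, legendreSym_selectFactor hsr] at this
    simpa only [Bool.not_true, legendreSym_selectFactor_false, one_mul, mul_one, boolSign_mul,
      boolSign_eq_one, Bool.xor_assoc, Bool.false_xor] using this

/-- The hypothesis `hC` isolates the purely Boolean deduction, so that the arithmetic is done once
for all of C1–C7. -/
theorem exists_splitting_of_five_primes (hp : p % 4 = 3) (hq : q % 4 = 3) (hr : r % 4 = 3)
    (hs : s % 4 = 1) {p2 q2 r2 s2 pq pr qr ps qs rs : Bool}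
    (hp2 : legendreSym p (2 : ℕ) = boolSign p2) (hq2 : legendreSym q (2 : ℕ) = boolSign q2)
    (hr2 : legendreSym r (2 : ℕ) = boolSign r2) (hs2 : legendreSym s (2 : ℕ) = boolSign s2)
    (hpq : legendreSym p q = boolSign pq) (hqp : legendreSym q p = boolSign !pq)
    (hpr : legendreSym p r = boolSign pr) (hrp : legendreSym r p = boolSign !pr)
    (hqr : legendreSym q r = boolSign qr) (hrq : legendreSym r q = boolSign !qr)
    (hps : legendreSym p s = boolSign ps) (hsp : legendreSym s p = boolSign ps)
    (hqs : legendreSym q s = boolSign qs) (hsq : legendreSym s q = boolSign qs)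
    (hrs : legendreSym r s = boolSign rs) (hsr : legendreSym s r = boolSign rs)
    (hC : ∀ x2 xp xq xr xs : Bool,
      ¬ (x2 = false ∧ xp = false ∧ xq = false ∧ xr = false ∧ xs = false) →
      (xp = false → ((x2 && p2) ^^ (xq && pq) ^^ (xr && pr) ^^ (xs && ps)) = false) →
      (xq = false → ((x2 && q2) ^^ (xp && !pq) ^^ (xr && qr) ^^ (xs && qs)) = false) →
      (xr = false → ((x2 && r2) ^^ (xp && !pr) ^^ (xq && !qr) ^^ (xs && rs)) = false) →
      (xs = false → ((x2 && s2) ^^ (xp && ps) ^^ (xq && qs) ^^ (xr && rs)) = false) →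
      (xp = true → (true ^^ (!x2 && p2) ^^ (!xq && pq) ^^ (!xr && pr) ^^ (!xs && ps)) = false) →
      (xq = true → (true ^^ (!x2 && q2) ^^ (!xp && !pq) ^^ (!xr && qr) ^^ (!xs && qs)) = false) →
      (xr = true → (true ^^ (!x2 && r2) ^^ (!xp && !pr) ^^ (!xq && !qr) ^^ (!xs && rs)) = false) →
      (xs = true → ((!x2 && s2) ^^ (!xp && ps) ^^ (!xq && qs) ^^ (!xr && rs)) = false) →
      (rs = true → xq ≠ xr) ∧ (rs = false → xq ≠ xs)) :
    ∃ (x2 xp xq xr xs : Bool) (d' a b : ℕ),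
      selectFactor x2 2 * (selectFactor xp p *
        (selectFactor xq q * (selectFactor xr r * selectFactor xs s))) * d' =
          2 * p * (q * r * s) ∧
      selectFactor x2 2 * (selectFactor xp p *
        (selectFactor xq q * (selectFactor xr r * selectFactor xs s))) * a ^ 2 =
          d' * b ^ 2 + 1 ∧
      (rs = true → xq ≠ xr) ∧ (rs = false → xq ≠ xs) := by
  have hpP : p.Prime := Fact.out
  have hqP : q.Prime := Fact.out
  have hrP : r.Prime := Fact.out
  have hsP : s.Prime := Fact.out
  have hns : ¬ IsSquare (2 * (p * (q * (r * (s * 1))))) := by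
    refine Nat.prime_two.not_isSquare_mul_of_not_dvd ?_
    rw [Nat.dvd_iff_mod_eq_zero]
    have h1 : (p * (q * (r * (s * 1)))) % 4 = 3 := by simp [Nat.mul_mod, hp, hq, hr, hs]
    omega
  have hmod : (2 * (p * (q * (r * (s * 1))))) % 4 = 2 := by
    simp [Nat.mul_mod, hp, hq, hr, hs]
  obtain ⟨d, d', a, b, hdd, hd1, heq⟩ := exists_mul_sq_eq_mul_sq_add_one hns (Or.inr hmod)
  obtain ⟨x2, d, d', rfl, rfl, hdd₁⟩ := exists_selectFactor Nat.prime_two hdd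
  obtain ⟨xp, d, d', rfl, rfl, hdd₂⟩ := exists_selectFactor hpP hdd₁
  obtain ⟨xq, d, d', rfl, rfl, hdd₃⟩ := exists_selectFactor hqP hdd₂
  obtain ⟨xr, d, d', rfl, rfl, hdd₄⟩ := exists_selectFactor hrP hdd₃
  obtain ⟨xs, d, d', rfl, rfl, hdd₅⟩ := exists_selectFactor hsP hdd₄
  obtain ⟨rfl, rfl⟩ := mul_eq_one.mp hdd₅
  simp only [mul_one] at heq hd1 hdd
  refine ⟨x2, xp, xq, xr, xs, _, a, b, hdd.trans (by ring), heq,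
    hC x2 xp xq xr xs ?_ ?_ ?_ ?_ ?_ ?_ ?_ ?_ ?_⟩
  · rintro ⟨rfl, rfl, rfl, rfl, rfl⟩
    exact hd1 rfl
  · rintro rfl
    have := legendreSym_eq_one_of_dvd_right (ℓ := p) heq
      (dvd_mul_of_dvd_right (dvd_mul_right _ _) _)
    rw [Nat.cast_mul, Nat.cast_mul, Nat.cast_mul, Nat.cast_mul,
      legendreSym.mul, legendreSym.mul, legendreSym.mul, legendreSym.mul,
      legendreSym_selectFactor hp2,
      legendreSym_selectFactor hpq,
      legendreSym_selectFactor hpr,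
      legendreSym_selectFactor hps] at this
    simpa only [Bool.not_true, legendreSym_selectFactor_false, one_mul, mul_one, boolSign_mul,
      boolSign_eq_one, Bool.xor_assoc, Bool.false_xor] using this
  · rintro rfl
    have := legendreSym_eq_one_of_dvd_right (ℓ := q) heq
      (dvd_mul_of_dvd_right (dvd_mul_of_dvd_right (dvd_mul_right _ _) _) _)
    rw [Nat.cast_mul, Nat.cast_mul, Nat.cast_mul, Nat.cast_mul,
      legendreSym.mul, legendreSym.mul, legendreSym.mul, legendreSym.mul,
      legendreSym_selectFactor hq2,
      legendreSym_selectFactor hqp,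
      legendreSym_selectFactor hqr,
      legendreSym_selectFactor hqs] at this
    simpa only [Bool.not_true, legendreSym_selectFactor_false, one_mul, mul_one, boolSign_mul,
      boolSign_eq_one, Bool.xor_assoc, Bool.false_xor] using this
  · rintro rfl
    have := legendreSym_eq_one_of_dvd_right (ℓ := r) heq
      (dvd_mul_of_dvd_right (dvd_mul_of_dvd_right (dvd_mul_of_dvd_right
        (dvd_mul_right _ _) _) _) _)
    rw [Nat.cast_mul, Nat.cast_mul, Nat.cast_mul, Nat.cast_mul,
      legendreSym.mul, legendreSym.mul, legendreSym.mul, legendreSym.mul,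
      legendreSym_selectFactor hr2,
      legendreSym_selectFactor hrp,
      legendreSym_selectFactor hrq,
      legendreSym_selectFactor hrs] at this
    simpa only [Bool.not_true, legendreSym_selectFactor_false, one_mul, mul_one, boolSign_mul,
      boolSign_eq_one, Bool.xor_assoc, Bool.false_xor] using this
  · rintro rfl
    have := legendreSym_eq_one_of_dvd_right (ℓ := s) heq
      (dvd_mul_of_dvd_right (dvd_mul_of_dvd_right (dvd_mul_of_dvd_right
        (dvd_mul_left _ _) _) _) _)
    rw [Nat.cast_mul, Nat.cast_mul, Nat.cast_mul, Nat.cast_mul,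
      legendreSym.mul, legendreSym.mul, legendreSym.mul, legendreSym.mul,
      legendreSym_selectFactor hs2,
      legendreSym_selectFactor hsp,
      legendreSym_selectFactor hsq,
      legendreSym_selectFactor hsr] at this
    simpa only [Bool.not_true, legendreSym_selectFactor_false, one_mul, mul_one, boolSign_mul,
      boolSign_eq_one, Bool.xor_assoc, Bool.false_xor] using this
  · rintro rfl
    have := legendreSym_eq_one_of_dvd_left (ℓ := p) heq
      (dvd_mul_of_dvd_right (dvd_mul_right _ _) _)
    rw [legendreSym_neg_one_of_mod_four_eq_three hp,
      Nat.cast_mul, Nat.cast_mul, Nat.cast_mul, Nat.cast_mul,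
      legendreSym.mul, legendreSym.mul, legendreSym.mul, legendreSym.mul,
      legendreSym_selectFactor hp2,
      legendreSym_selectFactor hpq,
      legendreSym_selectFactor hpr,
      legendreSym_selectFactor hps] at this
    simpa only [Bool.not_true, legendreSym_selectFactor_false, one_mul, mul_one, boolSign_mul,
      boolSign_eq_one, Bool.xor_assoc, Bool.false_xor] using this
  · rintro rfl
    have := legendreSym_eq_one_of_dvd_left (ℓ := q) heq
      (dvd_mul_of_dvd_right (dvd_mul_of_dvd_right (dvd_mul_right _ _) _) _)
    rw [legendreSym_neg_one_of_mod_four_eq_three hq,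
      Nat.cast_mul, Nat.cast_mul, Nat.cast_mul, Nat.cast_mul,
      legendreSym.mul, legendreSym.mul, legendreSym.mul, legendreSym.mul,
      legendreSym_selectFactor hq2,
      legendreSym_selectFactor hqp,
      legendreSym_selectFactor hqr,
      legendreSym_selectFactor hqs] at this
    simpa only [Bool.not_true, legendreSym_selectFactor_false, one_mul, mul_one, boolSign_mul,
      boolSign_eq_one, Bool.xor_assoc, Bool.false_xor] using this
  · rintro rfl
    have := legendreSym_eq_one_of_dvd_left (ℓ := r) heq
      (dvd_mul_of_dvd_right (dvd_mul_of_dvd_right (dvd_mul_of_dvd_right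
        (dvd_mul_right _ _) _) _) _)
    rw [legendreSym_neg_one_of_mod_four_eq_three hr,
      Nat.cast_mul, Nat.cast_mul, Nat.cast_mul, Nat.cast_mul,
      legendreSym.mul, legendreSym.mul, legendreSym.mul, legendreSym.mul,
      legendreSym_selectFactor hr2,
      legendreSym_selectFactor hrp,
      legendreSym_selectFactor hrq,
      legendreSym_selectFactor hrs] at this
    simpa only [Bool.not_true, legendreSym_selectFactor_false, one_mul, mul_one, boolSign_mul,
      boolSign_eq_one, Bool.xor_assoc, Bool.false_xor] using this
  · rintro rfl
    have := legendreSym_eq_one_of_dvd_left (ℓ := s) heq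
      (dvd_mul_of_dvd_right (dvd_mul_of_dvd_right (dvd_mul_of_dvd_right
        (dvd_mul_left _ _) _) _) _)
    rw [legendreSym_neg_one_of_mod_four_eq_one hs,
      Nat.cast_mul, Nat.cast_mul, Nat.cast_mul, Nat.cast_mul,
      legendreSym.mul, legendreSym.mul, legendreSym.mul, legendreSym.mul,
      legendreSym_selectFactor hs2,
      legendreSym_selectFactor hsp,
      legendreSym_selectFactor hsq,
      legendreSym_selectFactor hsr] at this
    simpa only [Bool.not_true, legendreSym_selectFactor_false, one_mul, mul_one, boolSign_mul,
      boolSign_eq_one, Bool.xor_assoc, Bool.false_xor] using this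

end Splittings

open NumberField

/-! ### Ostrowski ideals of Galois fields as radicals -/

section Ostrowski

theorem Ideal.liesOver_span_natCast {R : Type*} [CommRing R] {ℓ : ℕ} (hl : ℓ.Prime)
    (P : Ideal R) [P.IsPrime] (h : (ℓ : R) ∈ P) : P.LiesOver (Ideal.span {(ℓ : ℤ)}) := by
  have hmax : (Ideal.span {(ℓ : ℤ)}).IsMaximal :=
    (Nat.prime_iff_prime_int.mp hl).isMaximal_span_singleton
  refine ⟨hmax.eq_of_le (Ideal.IsPrime.under ℤ P).ne_top ?_⟩
  rw [Ideal.span_singleton_le_iff_mem, Ideal.mem_comap]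
  simpa using h

variable (K : Type*) [Field K] [NumberField K] [IsGalois ℚ K]

/-- In a Galois extension all primes above $\ell$ have the same residue degree, so one prime of norm
$\ell^f$ forces that norm on all of them. -/
theorem maximalIdealsOfNorm_eq {ℓ f : ℕ} (hl : ℓ.Prime)
    (h : (maximalIdealsOfNorm K (ℓ ^ f)).Nonempty) :
    maximalIdealsOfNorm K (ℓ ^ f) = {P | Ideal.span {(ℓ : 𝓞 K)} ≤ P ∧ P.IsPrime} := by
  have hmem : ∀ P ∈ maximalIdealsOfNorm K (ℓ ^ f), (ℓ : 𝓞 K) ∈ P := by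
    rintro P ⟨hP, hN⟩
    have := Ideal.absNorm_mem P
    rw [hN, Nat.cast_pow] at this
    exact hP.isPrime.mem_of_pow_mem _ this
  have hmax : (Ideal.span {(ℓ : ℤ)}).IsMaximal :=
    (Nat.prime_iff_prime_int.mp hl).isMaximal_span_singleton
  obtain ⟨P, hP⟩ := h
  have hPp : P.IsPrime := hP.1.isPrime
  have hPl := Ideal.liesOver_span_natCast hl P (hmem P hP)
  ext Q
  simp only [Set.mem_ofPred_eq, Ideal.span_singleton_le_iff_mem]
  refine ⟨fun hQ => ⟨hmem Q hQ, hQ.1.isPrime⟩, fun ⟨hQ, hQp⟩ => ?_⟩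
  have hQl := Ideal.liesOver_span_natCast hl Q hQ
  have hQm : Q.IsMaximal := by
    refine hQp.isMaximal ?_
    rintro rfl
    rw [Ideal.mem_bot] at hQ
    exact hl.ne_zero (by exact_mod_cast hQ)
  refine ⟨hQm, ?_⟩
  have hPm := hP.1
  rw [← hP.2, ← Ideal.natAbs_pow_inertiaDeg (ℓ : ℤ) P, ← Ideal.natAbs_pow_inertiaDeg (ℓ : ℤ) Q,
    Ideal.inertiaDeg_eq_of_isGaloisGroup (Ideal.span {(ℓ : ℤ)}) P Q Gal(K/ℚ)]

/-- Distinct maximal ideals are coprime, so their product is their intersection, here the radical of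
$(\ell)$. -/
theorem isPrincipal_ostrowskiIdeal_of_radical {ℓ f : ℕ} (hl : ℓ.Prime)
    (h : (Ideal.span {(ℓ : 𝓞 K)}).radical.IsPrincipal) :
    (ostrowskiIdeal K (ℓ ^ f)).IsPrincipal := by
  rcases (maximalIdealsOfNorm K (ℓ ^ f)).eq_empty_or_nonempty with he | he
  · have : ostrowskiIdeal K (ℓ ^ f) = ⊤ := by
      simp [ostrowskiIdeal, he]
    rw [this]
    exact top_isPrincipal
  · convert h
    rw [ostrowskiIdeal, Ideal.radical_eq_sInf, ← maximalIdealsOfNorm_eq K hl he,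
      Ideal.prod_eq_iInf_of_pairwise_isCoprime, sInf_eq_iInf]
    · simp
    · intro I hI J hJ hIJ
      simp only [Set.Finite.coe_toFinset] at hI hJ
      have := hI.1
      have := hJ.1
      exact Ideal.isCoprime_of_isMaximal hIJ

theorem isPolyaField_of_radical_isPrincipal
    (h : ∀ ℓ : ℕ, ℓ.Prime → (Ideal.span {(ℓ : 𝓞 K)}).radical.IsPrincipal) : IsPolyaField K :=
  fun ℓ _ hl _ => isPrincipal_ostrowskiIdeal_of_radical K hl (h ℓ hl)

end Ostrowski

/-! ### Elements of the radical of $(\ell)$ -/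

section Radical

theorem dvd_of_isCoprime_of_dvd_mul {R : Type*} [CommRing R] {π w : R} {k ℓ : ℤ}
    (h : IsCoprime k ℓ) (hl : π ∣ (ℓ : R)) (hk : π ∣ k * w) : π ∣ w := by
  obtain ⟨u, v, huv⟩ := h
  have h1 : (u * k + v * ℓ : R) = 1 := by exact_mod_cast congrArg (Int.cast (R := R)) huv
  have h2 : w = u * (k * w) + v * ℓ * w := by linear_combination -w * h1
  rw [h2]
  exact dvd_add (dvd_mul_of_dvd_right hk _) (dvd_mul_of_dvd_left (dvd_mul_of_dvd_right hl _) _)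

variable {K : Type*} [Field K] [NumberField K]

theorem NumberField.RingOfIntegers.exists_eq_intCast {z : 𝓞 K} {a : ℚ} (h : (z : K) = a) :
    ∃ k : ℤ, z = k ∧ a = k := by
  have h1 : IsIntegral ℤ (algebraMap ℚ K a) := by
    rw [eq_ratCast, ← h]
    exact z.isIntegral_coe
  rw [isIntegral_algebraMap_iff (algebraMap ℚ K).injective] at h1
  obtain ⟨k, hk⟩ := IsIntegrallyClosed.isIntegral_iff.mp h1
  have hk' : a = k := by rw [← hk]; simp
  refine ⟨k, ?_, hk'⟩
  ext
  rw [h, hk']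
  simp

/-- If $k^N=\ell w$, then $w=k^N/\ell$ is a rational algebraic integer, hence an integer, and $\ell$
is prime. -/
theorem dvd_of_intCast_mem_radical_span {ℓ : ℕ} (hl : ℓ.Prime) {k : ℤ}
    (h : (k : 𝓞 K) ∈ (Ideal.span {(ℓ : 𝓞 K)}).radical) : (ℓ : ℤ) ∣ k := by
  obtain ⟨N, hN⟩ := h
  obtain ⟨w, hw⟩ := Ideal.mem_span_singleton.mp hN
  have hl0 : (ℓ : ℚ) ≠ 0 := by exact_mod_cast hl.ne_zero
  have hl0' : (ℓ : K) ≠ 0 := by exact_mod_cast hl.ne_zero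
  have hw' : (k : K) ^ N = ℓ * (w : K) := by
    have := congrArg (algebraMap (𝓞 K) K) hw
    simpa using this
  obtain ⟨j, -, hj⟩ := RingOfIntegers.exists_eq_intCast (z := w) (a := (k : ℚ) ^ N / ℓ) (by
    push_cast
    rw [hw']
    field_simp)
  have hj' : k ^ N = ℓ * j := by
    rw [div_eq_iff hl0] at hj
    have : (k : ℚ) ^ N = ℓ * j := by rw [hj]; ring
    exact_mod_cast this
  exact (Nat.prime_iff_prime_int.mp hl).dvd_of_dvd_pow (Dvd.intro _ hj'.symm)

theorem map_mem_radical_span_natCast {R : Type*} [CommRing R] {ℓ : ℕ} (φ : R →+* R) {w : R}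
    (h : w ∈ (Ideal.span {(ℓ : R)}).radical) : φ w ∈ (Ideal.span {(ℓ : R)}).radical := by
  obtain ⟨N, hN⟩ := h
  refine ⟨N, ?_⟩
  rw [Ideal.mem_span_singleton] at hN ⊢
  simpa using map_dvd φ hN

theorem radical_span_eq_span_singleton {R : Type*} [CommRing R] {ℓ : ℕ} {π : R} {N : ℕ}
    (hπ : (ℓ : R) ∣ π ^ N) (h : ∀ w ∈ (Ideal.span {(ℓ : R)}).radical, π ∣ w) :
    (Ideal.span {(ℓ : R)}).radical = Ideal.span {π} := by
  apply le_antisymm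
  · intro w hw
    exact Ideal.mem_span_singleton.mpr (h w hw)
  · rw [Ideal.span_singleton_le_iff_mem]
    exact ⟨N, Ideal.mem_span_singleton.mpr hπ⟩

end Radical

/-- Square roots `X`, `Y` of `m` and `n` spanning the number field `K`, together with
automorphisms changing the sign of precisely one of them. -/
structure BiquadraticData (K : Type*) [Field K] [NumberField K] (m n : ℕ) where
  X : 𝓞 K
  Y : 𝓞 K
  X_sq : X ^ 2 = m
  Y_sq : Y ^ 2 = n
  σ : K →ₐ[ℚ] K
  τ : K →ₐ[ℚ] K
  σ_X : σ X = -X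
  σ_Y : σ Y = Y
  τ_X : τ X = X
  τ_Y : τ Y = -Y
  repr : ∀ z : K, ∃ a b c d : ℚ, z = a + b * X + c * Y + d * X * Y

/-! ### Radicals at odd primes -/

namespace BiquadraticData

variable {K : Type*} [Field K] [NumberField K] {m n : ℕ} (D : BiquadraticData K m n) {ℓ : ℕ}

theorem X_sq' : (D.X : K) ^ 2 = m := by
  have := congrArg (algebraMap (𝓞 K) K) D.X_sq
  simpa using this

theorem Y_sq' : (D.Y : K) ^ 2 = n := by
  have := congrArg (algebraMap (𝓞 K) K) D.Y_sq
  simpa using this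

/-- The trace of $w$ is $4a$. The radical is stable under automorphisms, so the trace lies in its
intersection with $\mathbb{Z}$, which is $\ell\mathbb{Z}$. -/
theorem exists_four_mul_eq (hl : ℓ.Prime) {w : 𝓞 K}
    (hw : w ∈ (Ideal.span {(ℓ : 𝓞 K)}).radical) {a b c d : ℚ}
    (h : (w : K) = a + b * D.X + c * D.Y + d * D.X * D.Y) : ∃ k : ℤ, 4 * a = ℓ * k := by
  set σ' := RingOfIntegers.mapRingHom D.σ.toRingHom
  set τ' := RingOfIntegers.mapRingHom D.τ.toRingHom
  have hmem : w + τ' w + σ' w + σ' (τ' w) ∈ (Ideal.span {(ℓ : 𝓞 K)}).radical :=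
    add_mem (add_mem (add_mem hw (map_mem_radical_span_natCast _ hw))
      (map_mem_radical_span_natCast _ hw))
      (map_mem_radical_span_natCast _ (map_mem_radical_span_natCast _ hw))
  have hval : ((w + τ' w + σ' w + σ' (τ' w) : 𝓞 K) : K) = ((4 * a : ℚ) : K) := by
    have hτ : ((τ' w : 𝓞 K) : K) = D.τ w := rfl
    have hσ : ((σ' w : 𝓞 K) : K) = D.σ w := rfl
    have hστ : ((σ' (τ' w) : 𝓞 K) : K) = D.σ (D.τ w) := rfl
    simp only [map_add, hτ, hσ, hστ, h, map_mul, map_ratCast, D.σ_X, D.σ_Y, D.τ_X, D.τ_Y, map_neg]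
    push_cast
    ring
  obtain ⟨k, hk, hk'⟩ := RingOfIntegers.exists_eq_intCast hval
  rw [hk] at hmem
  obtain ⟨j, rfl⟩ := dvd_of_intCast_mem_radical_span hl hmem
  exact ⟨j, by rw [hk']; push_cast; ring⟩

theorem exists_four_mul_mul_mul_eq (hl : ℓ.Prime) {w : 𝓞 K}
    (hw : w ∈ (Ideal.span {(ℓ : 𝓞 K)}).radical) :
    ∃ A B C E : ℤ, 4 * m * n * w =
      ℓ * (m * n * A + n * B * D.X + m * C * D.Y + E * D.X * D.Y) := by
  obtain ⟨a, b, c, d, h⟩ := D.repr w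
  -- The trace argument is applied to $w$, $wX$, $wY$ and $wXY$, which isolates each of the four
  -- coordinates of $w$.
  have hX := D.X_sq'
  have hY := D.Y_sq'
  obtain ⟨A, hA⟩ := D.exists_four_mul_eq hl hw h
  obtain ⟨B, hB⟩ := D.exists_four_mul_eq hl (Ideal.mul_mem_right D.X _ hw)
    (a := b * m) (b := a) (c := d * m) (d := c) (by
      simp only [map_mul, h]; push_cast; linear_combination (b + d * D.Y) * hX)
  obtain ⟨C, hC⟩ := D.exists_four_mul_eq hl (Ideal.mul_mem_right D.Y _ hw)
    (a := c * n) (b := d * n) (c := a) (d := b) (by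
      simp only [map_mul, h]; push_cast; linear_combination (c + d * D.X) * hY)
  obtain ⟨E, hE⟩ := D.exists_four_mul_eq hl (Ideal.mul_mem_right (D.X * D.Y) _ hw)
    (a := d * m * n) (b := c * n) (c := b * m) (d := a) (by
      simp only [map_mul, h]; push_cast
      linear_combination (b * D.Y + d * n) * hX + (c * D.X + d * D.X ^ 2) * hY)
  refine ⟨A, B, C, E, ?_⟩
  ext
  simp only [map_mul, map_add, map_natCast, map_intCast, map_ofNat, h]
  have hA' := congrArg (Rat.cast (K := K)) hA
  have hB' := congrArg (Rat.cast (K := K)) hB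
  have hC' := congrArg (Rat.cast (K := K)) hC
  have hE' := congrArg (Rat.cast (K := K)) hE
  push_cast at hA' hB' hC' hE'
  linear_combination m * n * hA' + n * D.X * hB' + m * D.Y * hC' + D.X * D.Y * hE'

/-- The same data with the roles of the two square roots exchanged. -/
def swap : BiquadraticData K n m where
  X := D.Y
  Y := D.X
  X_sq := D.Y_sq
  Y_sq := D.X_sq
  σ := D.τ
  τ := D.σ
  σ_X := D.τ_Y
  σ_Y := D.τ_X
  τ_X := D.σ_Y
  τ_Y := D.σ_X
  repr z := by
    obtain ⟨a, b, c, d, h⟩ := D.repr z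
    exact ⟨a, c, b, d, by rw [h]; ring⟩

theorem radical_span_of_not_dvd (D : BiquadraticData K m n)
    (hl : ℓ.Prime) (hl2 : ℓ ≠ 2) (hm : ¬ ℓ ∣ m) (hn : ¬ ℓ ∣ n) :
    (Ideal.span {(ℓ : 𝓞 K)}).radical = Ideal.span {(ℓ : 𝓞 K)} := by
  refine radical_span_eq_span_singleton (N := 1) (by simp) fun w hw => ?_
  obtain ⟨A, B, C, E, h⟩ := D.exists_four_mul_mul_mul_eq hl hw
  refine dvd_of_isCoprime_of_dvd_mul (k := ((4 * m * n : ℕ) : ℤ)) (ℓ := ℓ) ?_ (by simp)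
    ⟨_, by push_cast; exact h⟩
  rw [Nat.isCoprime_iff_coprime, Nat.coprime_comm, hl.coprime_iff_not_dvd, hl.dvd_mul, hl.dvd_mul,
    show 4 = 2 ^ 2 from rfl]
  have : ¬ ℓ ∣ 2 ^ 2 := fun h => hl2 ((Nat.prime_dvd_prime_iff_eq hl Nat.prime_two).mp
    (hl.dvd_of_dvd_pow h))
  tauto

theorem radical_span_of_dvd_right (D : BiquadraticData K m n)
    (hl : ℓ.Prime) (hl2 : ℓ ≠ 2) (hm : ¬ ℓ ∣ m) {n' : ℕ}
    (hn : n = ℓ * n') (hn' : ¬ ℓ ∣ n') {π : 𝓞 K} (hπ : Associated (π ^ 2) (ℓ : 𝓞 K)) :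
    (Ideal.span {(ℓ : 𝓞 K)}).radical = Ideal.span {π} := by
  refine radical_span_eq_span_singleton (N := 2) hπ.symm.dvd fun w hw => ?_
  obtain ⟨A, B, C, E, h⟩ := D.exists_four_mul_mul_mul_eq hl hw
  have hl0 : (ℓ : 𝓞 K) ≠ 0 := by exact_mod_cast hl.ne_zero
  have hπl : π ∣ ℓ := (dvd_pow_self π two_ne_zero).trans hπ.dvd
  -- $\pi^2$ divides $\ell$, hence $n=Y^2$; divisibility of squares descends to the elements because
  -- the ring is integrally closed.
  have hπY : π ∣ D.Y := by
    rw [← IsIntegrallyClosed.pow_dvd_pow_iff two_ne_zero, D.Y_sq, hn, Nat.cast_mul]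
    exact dvd_mul_of_dvd_left hπ.dvd _
  refine dvd_of_isCoprime_of_dvd_mul (k := ((4 * m * n' : ℕ) : ℤ)) (ℓ := ℓ) ?_
    (by exact_mod_cast hπl) ?_
  · rw [Nat.isCoprime_iff_coprime, Nat.coprime_comm, hl.coprime_iff_not_dvd, hl.dvd_mul,
      hl.dvd_mul, show 4 = 2 ^ 2 from rfl]
    have : ¬ ℓ ∣ 2 ^ 2 := fun h => hl2 ((Nat.prime_dvd_prime_iff_eq hl Nat.prime_two).mp
      (hl.dvd_of_dvd_pow h))
    tauto
  · have h' : ((4 * m * n' : ℕ) : ℤ) * w =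
        ℓ * (m * n' * A + n' * B * D.X) + D.Y * (m * C + E * D.X) := by
      apply mul_left_cancel₀ hl0
      have hn'' : (n : 𝓞 K) = ℓ * n' := by exact_mod_cast congrArg (Nat.cast (R := 𝓞 K)) hn
      rw [hn''] at h
      push_cast
      linear_combination h
    rw [h']
    exact dvd_add (dvd_mul_of_dvd_left hπl _) (dvd_mul_of_dvd_left hπY _)

theorem radical_span_of_dvd_left (D : BiquadraticData K m n)
    (hl : ℓ.Prime) (hl2 : ℓ ≠ 2) (hn : ¬ ℓ ∣ n) {m' : ℕ}
    (hm : m = ℓ * m') (hm' : ¬ ℓ ∣ m') {π : 𝓞 K} (hπ : Associated (π ^ 2) (ℓ : 𝓞 K)) :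
    (Ideal.span {(ℓ : 𝓞 K)}).radical = Ideal.span {π} :=
  D.swap.radical_span_of_dvd_right hl hl2 hn hm hm' hπ

end BiquadraticData

/-! ### The radical at 2 -/

namespace BiquadraticData

variable {K : Type*} [Field K] [NumberField K] {m n : ℕ}

/-- This is the ring of integers $\mathbb{Z}[\sqrt m]$ of $\mathbb{Q}(\sqrt m)$: the traces of $w$
and $wX$ and the norm of $w$ are integers, and $m\equiv 2\pmod 4$ removes the denominator 2. -/
theorem exists_eq_add_mul_X_of_τ_eq (D : BiquadraticData K m n) (hm : m % 4 = 2)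
    (hm' : Squarefree m) {w : 𝓞 K} (hw : D.τ w = w) :
    ∃ A B : ℤ, w = A + B * D.X := by
  have hX := D.X_sq'
  obtain ⟨a, b, h⟩ : ∃ a b : ℚ, (w : K) = a + b * D.X := by
    obtain ⟨a, b, c, d, h⟩ := D.repr w
    refine ⟨a, b, ?_⟩
    have h2 : D.τ w = a + b * D.X - c * D.Y - d * D.X * D.Y := by
      rw [h]
      simp only [map_add, map_mul, map_ratCast, D.τ_X, D.τ_Y]
      ring
    -- Averaging $w$ with its image under `τ` kills the coordinates on $Y$ and $XY$.
    linear_combination (1 / 2 : K) * h + (1 / 2 : K) * h2 - (1 / 2 : K) * hw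
  set σ' := RingOfIntegers.mapRingHom D.σ.toRingHom
  have hσ : ((σ' w : 𝓞 K) : K) = a - b * D.X := by
    change D.σ w = _
    rw [h]
    simp only [map_add, map_mul, map_ratCast, D.σ_X]
    ring
  have hσX : ((σ' D.X : 𝓞 K) : K) = - D.X := D.σ_X
  obtain ⟨A, -, hA⟩ := RingOfIntegers.exists_eq_intCast (z := w + σ' w) (a := 2 * a) (by
    simp only [map_add, h, hσ]; push_cast; ring)
  obtain ⟨C, -, hC⟩ := RingOfIntegers.exists_eq_intCast (z := w * D.X + σ' w * σ' D.X)
    (a := 2 * b * m) (by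
    simp only [map_add, map_mul, h, hσ, hσX]; push_cast; linear_combination 2 * b * hX)
  obtain ⟨N, -, hN⟩ := RingOfIntegers.exists_eq_intCast (z := w * σ' w)
    (a := a ^ 2 - b ^ 2 * m) (by
    simp only [map_mul, h, hσ]; push_cast; linear_combination - b ^ 2 * hX)
  have hm0 : (m : ℚ) ≠ 0 := by exact_mod_cast hm'.ne_zero
  have h1 : (m : ℤ) * A ^ 2 - C ^ 2 = 4 * N * m := by
    have : (m : ℚ) * A ^ 2 - C ^ 2 = 4 * N * m := by
      rw [← hA, ← hC, ← hN]; ring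
    exact_mod_cast this
  have hdvd : (m : ℤ) ∣ C := by
    have hsq : Squarefree (m : ℤ) := Int.squarefree_natCast.mpr hm'
    rw [← hsq.dvd_pow_iff_dvd two_ne_zero]
    exact ⟨A ^ 2 - 4 * N, by linear_combination -h1⟩
  obtain ⟨B, rfl⟩ := hdvd
  have hB : 2 * b = B := by
    push_cast at hC
    exact mul_right_cancel₀ hm0 (by rw [hC]; ring)
  have h2 : A ^ 2 - m * B ^ 2 = 4 * N := by
    have : (A : ℚ) ^ 2 - m * B ^ 2 = 4 * N := by rw [← hA, ← hB, ← hN]; ring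
    exact_mod_cast this
  obtain ⟨k, hk⟩ : ∃ k : ℤ, (m : ℤ) = 4 * k + 2 := ⟨m / 4, by omega⟩
  rw [hk] at h2
  have hAe : Even A := by
    rw [← Int.even_pow' two_ne_zero]
    exact ⟨(2 * k + 1) * B ^ 2 + 2 * N, by linear_combination h2⟩
  obtain ⟨A', rfl⟩ := hAe
  have hBe : Even B := by
    rw [← Int.even_pow' two_ne_zero]
    exact ⟨A' ^ 2 - N - k * B ^ 2, by linarith⟩
  obtain ⟨B', rfl⟩ := hBe
  refine ⟨A', B', ?_⟩
  ext
  push_cast at hA hB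
  have hA' : a = A' := by linarith
  have hB' : b = B' := by linarith
  simp [h, hA', hB']

theorem exists_two_mul_eq_one_add_Y (D : BiquadraticData K m n) (hn : n % 4 = 1) :
    ∃ ω : 𝓞 K, 2 * ω = 1 + D.Y := by
  obtain ⟨k, hk⟩ : ∃ k : ℕ, n = 4 * k + 1 := ⟨n / 4, by omega⟩
  have hY := D.Y_sq'
  have hn' : (n : K) = 4 * k + 1 := by exact_mod_cast congrArg (Nat.cast (R := K)) hk
  have hint : IsIntegral ℤ ((1 + D.Y : K) / 2) := by
    refine ⟨Polynomial.X ^ 2 - Polynomial.X - Polynomial.C (k : ℤ), by monicity!, ?_⟩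
    simp
    linear_combination (1 / 4 : K) * hY + (1 / 4 : K) * hn'
  refine ⟨⟨_, hint⟩, ?_⟩
  ext
  change (2 : K) * ((1 + D.Y) / 2) = 1 + D.Y
  ring

/-- The odd-prime argument has denominator 4, useless at 2. Instead one descends to
$\mathbb{Q}(\sqrt m)$, over which $K$ is unramified at 2: relative traces of $w$ and $w\omega$, with
$\omega=(1+\sqrt n)/2$, determine $w$ up to the odd factor $n$. -/
theorem radical_span_two (D : BiquadraticData K m n) (hm : m % 4 = 2) (hm' : Squarefree m)
    (hn : n % 4 = 1) {π : 𝓞 K} (hπ : Associated (π ^ 2) ((2 : ℕ) : 𝓞 K)) :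
    (Ideal.span {((2 : ℕ) : 𝓞 K)}).radical = Ideal.span {π} := by
  have hπ2 : π ∣ ((2 : ℕ) : 𝓞 K) := (dvd_pow_self π two_ne_zero).trans hπ.dvd
  have hπX : π ∣ D.X := by
    rw [← IsIntegrallyClosed.pow_dvd_pow_iff two_ne_zero, D.X_sq]
    exact hπ.dvd.trans (Nat.cast_dvd_cast (by omega))
  set τ' := RingOfIntegers.mapRingHom D.τ.toRingHom
  have hfix : ∀ w ∈ (Ideal.span {((2 : ℕ) : 𝓞 K)}).radical, τ' w = w → π ∣ w := by
    intro w hw hτ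
    obtain ⟨A, B, rfl⟩ := D.exists_eq_add_mul_X_of_τ_eq hm hm'
      (congrArg (algebraMap (𝓞 K) K) hτ)
    have hmem : (((A ^ 2 - m * B ^ 2 : ℤ)) : 𝓞 K) ∈
        (Ideal.span {((2 : ℕ) : 𝓞 K)}).radical := by
      -- Multiplying by the conjugate gives the norm $A^2-mB^2$, which is therefore even; as $m$ is
      -- even, so is $A$.
      have := Ideal.mul_mem_right (A - B * D.X) _ hw
      convert this using 1
      push_cast
      linear_combination B ^ 2 * D.X_sq
    have h2 := dvd_of_intCast_mem_radical_span Nat.prime_two hmem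
    have hA : (2 : ℤ) ∣ A := by
      apply Int.prime_two.dvd_of_dvd_pow (n := 2)
      obtain ⟨k, hk⟩ : ∃ k : ℤ, (m : ℤ) = 2 * k := ⟨m / 2, by omega⟩
      obtain ⟨j, hj⟩ := h2
      refine ⟨j + k * B ^ 2, ?_⟩
      push_cast at hj
      rw [hk] at hj
      linear_combination hj
    obtain ⟨A', rfl⟩ := hA
    refine dvd_add ?_ (dvd_mul_of_dvd_right hπX _)
    push_cast at hπ2 ⊢
    exact dvd_mul_of_dvd_left hπ2 _
  obtain ⟨ω, hω⟩ := D.exists_two_mul_eq_one_add_Y hn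
  have hτY : τ' D.Y = - D.Y := by
    ext
    exact D.τ_Y
  have hττ : ∀ w, τ' (τ' w) = w := by
    intro w
    ext
    change D.τ (D.τ w) = w
    obtain ⟨a, b, c, d, h⟩ := D.repr w
    rw [h]
    simp [D.τ_X, D.τ_Y]
  have h20 : (2 : 𝓞 K) ≠ 0 := two_ne_zero
  have hτω : τ' ω = 1 - ω := by
    apply mul_left_cancel₀ h20
    have := congrArg τ' hω
    simp only [map_mul, map_ofNat, map_add, map_one, hτY] at this
    linear_combination this + hω
  have htrace : ∀ w ∈ (Ideal.span {((2 : ℕ) : 𝓞 K)}).radical, π ∣ w + τ' w := by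
    intro w hw
    refine hfix _ (add_mem hw (map_mem_radical_span_natCast _ hw)) ?_
    rw [map_add, hττ, add_comm]
  refine radical_span_eq_span_singleton (N := 2) hπ.symm.dvd fun w hw => ?_
  have hT := htrace w hw
  have hT' := htrace (w * ω) (Ideal.mul_mem_right ω _ hw)
  rw [map_mul, hτω] at hT'
  obtain ⟨k, hk⟩ : ∃ k : ℕ, n = 4 * k + 1 := ⟨n / 4, by omega⟩
  have hn' : (n : 𝓞 K) = 4 * k + 1 := by exact_mod_cast congrArg (Nat.cast (R := 𝓞 K)) hk
  have hωω : ω ^ 2 = ω + k := by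
    apply mul_left_cancel₀ (mul_ne_zero h20 h20)
    linear_combination (2 * ω + D.Y - 1) * hω + D.Y_sq + hn'
  refine dvd_of_isCoprime_of_dvd_mul (k := ((n : ℕ) : ℤ)) (ℓ := (2 : ℕ)) ?_
    (by exact_mod_cast hπ2) ?_
  · rw [Nat.isCoprime_iff_coprime, Nat.coprime_two_right, Nat.odd_iff]
    omega
  -- This eliminates the conjugate of $w$ from the two traces, using $(2\omega-1)^2=n$.
  · have : ((n : ℤ) : 𝓞 K) * w = (w + τ' w) * (2 * k + 1 - ω) +
        (w * ω + τ' w * (1 - ω)) * (2 * ω - 1) := by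
      push_cast
      rw [hn']
      linear_combination (-2 * w + 2 * τ' w) * hωω
    rw [this]
    exact dvd_add (dvd_mul_of_dvd_left hT _) (dvd_mul_of_dvd_left hT' _)

end BiquadraticData

open IntermediateField

/-! ### Coordinates and automorphisms of a field generated by two square roots -/

section Generation

variable {L : Type*} [Field L] [Algebra ℚ L] {m n : ℚ} {x y : L}

theorem isIntegral_of_sq_eq_algebraMap (hx : x ^ 2 = algebraMap ℚ L m) : IsIntegral ℚ x :=
  IsIntegral.of_pow two_pos (hx ▸ isIntegral_algebraMap)

theorem exists_eq_of_mem_adjoin_pair_sqrt (hx : x ^ 2 = algebraMap ℚ L m)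
    (hy : y ^ 2 = algebraMap ℚ L n) {z : L} (hz : z ∈ adjoin ℚ {x, y}) :
    ∃ a b c d : ℚ, z = algebraMap ℚ L a + algebraMap ℚ L b * x + algebraMap ℚ L c * y +
      algebraMap ℚ L d * x * y := by
  rw [← mem_toSubalgebra, adjoin_toSubalgebra_of_isAlgebraic] at hz
  swap
  · rintro w (rfl | rfl)
    · exact (isIntegral_of_sq_eq_algebraMap hx).isAlgebraic
    · exact (isIntegral_of_sq_eq_algebraMap hy).isAlgebraic
  induction hz using Algebra.adjoin_induction with
  | mem w hw =>
    rcases hw with rfl | rfl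
    · exact ⟨0, 1, 0, 0, by simp⟩
    · exact ⟨0, 0, 1, 0, by simp⟩
  | algebraMap r => exact ⟨r, 0, 0, 0, by simp⟩
  | add w z _ _ hw hz =>
    obtain ⟨a, b, c, d, rfl⟩ := hw
    obtain ⟨a', b', c', d', rfl⟩ := hz
    exact ⟨a + a', b + b', c + c', d + d', by simp only [map_add]; ring⟩
  | mul w z _ _ hw hz =>
    obtain ⟨a, b, c, d, rfl⟩ := hw
    obtain ⟨a', b', c', d', rfl⟩ := hz
    refine ⟨a * a' + m * b * b' + n * c * c' + m * n * d * d',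
      a * b' + b * a' + n * (c * d' + d * c'), a * c' + c * a' + m * (b * d' + d * b'),
      a * d' + d * a' + b * c' + c * b', ?_⟩
    simp only [map_add, map_mul, ← hx, ← hy]
    ring

theorem exists_eq_of_mem_adjoin_sqrt (hx : x ^ 2 = algebraMap ℚ L m) {z : L}
    (hz : z ∈ ℚ⟮x⟯) : ∃ a b : ℚ, z = algebraMap ℚ L a + algebraMap ℚ L b * x := by
  have hz' : z ∈ adjoin ℚ {x, (0 : L)} := adjoin.mono _ _ _ (by simp) hz
  obtain ⟨a, b, c, d, h⟩ := exists_eq_of_mem_adjoin_pair_sqrt hx (n := 0) (by simp) hz'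
  exact ⟨a, b, by simpa using h⟩

theorem notMem_adjoin_sqrt [CharZero L] (hx : x ^ 2 = algebraMap ℚ L m)
    (hy : y ^ 2 = algebraMap ℚ L n)
    (hm : ¬ IsSquare m) (hn : ¬ IsSquare n) (hmn : ¬ IsSquare (m * n)) : y ∉ ℚ⟮x⟯ := by
  intro hmem
  obtain ⟨a, b, h⟩ := exists_eq_of_mem_adjoin_sqrt hx hmem
  have hinj := (algebraMap ℚ L).injective
  have key : algebraMap ℚ L (n - a ^ 2 - m * b ^ 2) = algebraMap ℚ L (2 * a * b) * x := by
    simp only [map_sub, map_mul, map_pow, map_ofNat, ← hx, ← hy, h]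
    ring
  by_cases hab : 2 * a * b = 0
  · rw [hab, map_zero, zero_mul, map_eq_zero] at key
    rcases (by simpa using hab : a = 0 ∨ b = 0) with rfl | rfl
    · exact hmn ⟨m * b, by linear_combination m * key⟩
    · exact hn ⟨a, by linear_combination key⟩
  · have hab' : algebraMap ℚ L (2 * a * b) ≠ 0 := by simpa using hab
    have hxq : x = algebraMap ℚ L ((n - a ^ 2 - m * b ^ 2) / (2 * a * b)) := by
      rw [map_div₀, key]
      field_simp
    rw [hxq, ← map_pow] at hx
    exact hm ⟨_, by rw [← hinj hx, sq]⟩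

/-- An automorphism fixing `√m` and changing the sign of `√n`. -/
theorem exists_algHom_neg_sqrt [CharZero L] [FiniteDimensional ℚ L] [IsGalois ℚ L]
    (hx : x ^ 2 = algebraMap ℚ L m) (hy : y ^ 2 = algebraMap ℚ L n)
    (hm : ¬ IsSquare m) (hn : ¬ IsSquare n) (hmn : ¬ IsSquare (m * n)) :
    ∃ τ : L →ₐ[ℚ] L, τ x = x ∧ τ y = -y := by
  by_contra! hcon
  refine notMem_adjoin_sqrt hx hy hm hn hmn ?_
  -- If no automorphism fixing $x$ negated $y$, all of them would fix $y$, and the Galois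
  -- correspondence would put $y$ in $\mathbb{Q}(x)$.
  have hbot : y ∈ (⊥ : IntermediateField ℚ⟮x⟯ L) := by
    rw [IsGalois.mem_bot_iff_fixed]
    intro f
    have hfx : f x = x := f.commutes ⟨x, mem_adjoin_simple_self ℚ x⟩
    have hfy : f y ^ 2 = y ^ 2 := by
      rw [← map_pow, hy, IsScalarTower.algebraMap_apply ℚ ℚ⟮x⟯ L, f.commutes]
    refine (sq_eq_sq_iff_eq_or_eq_neg.mp hfy).resolve_right ?_
    exact hcon (f.restrictScalars ℚ).toAlgHom hfx
  obtain ⟨z, hz⟩ := mem_bot.mp hbot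
  rw [← hz]
  exact z.2

end Generation

/-! ### The real biquadratic field -/

section Real

variable (m n : ℕ)

theorem sqrt_left_mem : Real.sqrt m ∈ realBiquadraticField m n :=
  subset_adjoin _ _ (by simp)

theorem sqrt_right_mem : Real.sqrt n ∈ realBiquadraticField m n :=
  subset_adjoin _ _ (by simp)

instance isGalois_realBiquadraticField : IsGalois ℚ (realBiquadraticField m n) := by
  have hsplit : ∀ (k : ℕ), Real.sqrt k ∈ realBiquadraticField m n →
      ((minpoly ℚ (Real.sqrt k)).map (algebraMap ℚ (realBiquadraticField m n))).Splits := by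
    intro k hk
    have hdvd : minpoly ℚ (Real.sqrt k) ∣ Polynomial.X ^ 2 - Polynomial.C (k : ℚ) :=
      minpoly.dvd _ _ (by simp)
    have hdvd' := Polynomial.map_dvd (algebraMap ℚ (realBiquadraticField m n)) hdvd
    set x : realBiquadraticField m n := ⟨_, hk⟩
    have hx : x ^ 2 = k := by
      ext
      simp [x]
    have hfac : (Polynomial.X ^ 2 - Polynomial.C (k : ℚ)).map
        (algebraMap ℚ (realBiquadraticField m n)) =
        (Polynomial.X - Polynomial.C x) * (Polynomial.X + Polynomial.C x) := by
      rw [Polynomial.map_sub, Polynomial.map_pow, Polynomial.map_X, Polynomial.map_C,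
        map_natCast, ← hx, Polynomial.C_pow]
      ring
    rw [hfac] at hdvd'
    refine Polynomial.Splits.of_dvd ((Polynomial.Splits.X_sub_C x).mul
      (Polynomial.Splits.X_add_C x)) ?_ hdvd'
    exact mul_ne_zero (Polynomial.X_sub_C_ne_zero x) (Polynomial.X_add_C_ne_zero x)
  have hnormal : Normal ℚ (realBiquadraticField m n) := by
    refine normal_iff.mpr fun z => ⟨IsIntegral.of_finite ℚ z, ?_⟩
    rw [← minpoly.algebraMap_eq (algebraMap (realBiquadraticField m n) ℝ).injective]
    refine splits_of_mem_adjoin ℚ ℝ (S := {Real.sqrt m, Real.sqrt n}) ?_ z.2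
    rintro w (rfl | rfl)
    · exact ⟨isIntegral_sqrt_natCast m, hsplit m (sqrt_left_mem m n)⟩
    · exact ⟨isIntegral_sqrt_natCast n, hsplit n (sqrt_right_mem m n)⟩
  exact ⟨⟩

theorem nonempty_biquadraticData (hm : ¬ IsSquare m) (hn : ¬ IsSquare n)
    (hmn : ¬ IsSquare (m * n)) : Nonempty (BiquadraticData (realBiquadraticField m n) m n) := by
  set K := realBiquadraticField m n
  set x : K := ⟨_, sqrt_left_mem m n⟩
  set y : K := ⟨_, sqrt_right_mem m n⟩
  have hx : x ^ 2 = m := by ext; simp [x]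
  have hy : y ^ 2 = n := by ext; simp [y]
  have hx' : x ^ 2 = algebraMap ℚ K m := by rw [hx, map_natCast]
  have hy' : y ^ 2 = algebraMap ℚ K n := by rw [hy, map_natCast]
  have hmQ : ¬ IsSquare (m : ℚ) := by rwa [Rat.isSquare_natCast_iff]
  have hnQ : ¬ IsSquare (n : ℚ) := by rwa [Rat.isSquare_natCast_iff]
  have hmnQ : ¬ IsSquare ((m : ℚ) * n) := by
    rw [← Nat.cast_mul]
    rwa [Rat.isSquare_natCast_iff]
  obtain ⟨τ, hτx, hτy⟩ := exists_algHom_neg_sqrt hx' hy' hmQ hnQ hmnQ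
  obtain ⟨σ, hσy, hσx⟩ := exists_algHom_neg_sqrt hy' hx' hnQ hmQ (by rwa [mul_comm])
  have hxi : IsIntegral ℤ x := .of_pow two_pos (hx ▸ isIntegral_natCast m)
  have hyi : IsIntegral ℤ y := .of_pow two_pos (hy ▸ isIntegral_natCast n)
  refine ⟨⟨⟨x, hxi⟩, ⟨y, hyi⟩, ?_, ?_, σ, τ, hσx, hσy, hτx, hτy, fun z => ?_⟩⟩
  · exact RingOfIntegers.ext (hx.trans (map_natCast _ m).symm)
  · exact RingOfIntegers.ext (hy.trans (map_natCast _ n).symm)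
  · have hxR : (Real.sqrt m) ^ 2 = algebraMap ℚ ℝ m := by simp
    have hyR : (Real.sqrt n) ^ 2 = algebraMap ℚ ℝ n := by simp
    obtain ⟨a, b, c, d, h⟩ := exists_eq_of_mem_adjoin_pair_sqrt hxR hyR z.2
    have hz : z = a + b * x + c * y + d * x * y := by
      ext
      simpa [x, y] using h
    exact ⟨a, b, c, d, hz⟩

end Real

/-! ### Integers that are squares up to units -/

section SquareUpToUnit

variable (K : Type*) [Field K]

/-- The integer `d` is a square up to a unit in the ring of integers of `K`. -/
def IsSquareUpToUnit (d : ℕ) : Prop := ∃ π : 𝓞 K, Associated (π ^ 2) (d : 𝓞 K)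

variable {K} {a b d d' N : ℕ}

theorem isSquareUpToUnit_of_sq_eq {Z : 𝓞 K} (hZ : Z ^ 2 = N) : IsSquareUpToUnit K N :=
  ⟨Z, hZ ▸ Associated.refl _⟩

variable [NumberField K]

/-- With $\pi^2\sim a$ and $\rho^2\sim ab$, one gets $(\pi\rho)^2\sim a^2b$, so $a$ divides
$\pi\rho$ by integral closedness; the quotient is the root for $b$. -/
theorem IsSquareUpToUnit.of_mul_left (hA : IsSquareUpToUnit K a)
    (hAB : IsSquareUpToUnit K (a * b)) (ha : a ≠ 0) : IsSquareUpToUnit K b := by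
  obtain ⟨π, hπ⟩ := hA
  obtain ⟨ρ, hρ⟩ := hAB
  have ha' : (a : 𝓞 K) ≠ 0 := by exact_mod_cast ha
  have h : Associated ((π * ρ) ^ 2) ((a : 𝓞 K) ^ 2 * b) := by
    have := hπ.mul_mul hρ
    push_cast at this
    rwa [← mul_pow, ← mul_assoc, ← sq] at this
  have hdvd : (a : 𝓞 K) ∣ π * ρ := by
    rw [← IsIntegrallyClosed.pow_dvd_pow_iff two_ne_zero]
    exact (dvd_mul_right _ _).trans h.symm.dvd
  obtain ⟨t, ht⟩ := hdvd
  rw [ht, mul_pow] at h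
  exact ⟨t, Associated.of_mul_left h (Associated.refl _) (pow_ne_zero 2 ha')⟩

theorem IsSquareUpToUnit.of_selectFactor_mul (hA : IsSquareUpToUnit K a) {x : Bool}
    (hAB : IsSquareUpToUnit K (selectFactor x a * b)) (ha : a ≠ 0) : IsSquareUpToUnit K b := by
  cases x
  · simpa [selectFactor] using hAB
  · exact hA.of_mul_left hAB ha

theorem isSquareUpToUnit_of_splitting {Z : 𝓞 K} (hZ : Z ^ 2 = N) (hd : d * d' = N)
    (h : d * a ^ 2 = d' * b ^ 2 + 1) : IsSquareUpToUnit K d := by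
  have h' : (d * a ^ 2 : 𝓞 K) = d' * b ^ 2 + 1 := by exact_mod_cast congrArg (Nat.cast (R := 𝓞 K)) h
  have hd' : (d * d' : 𝓞 K) = Z ^ 2 := by rw [hZ]; exact_mod_cast congrArg (Nat.cast (R := 𝓞 K)) hd
  -- The two factors are $x\pm y\sqrt N$ for the Pell solution, and their product is
  -- $(da^2-d'b^2)^2=1$.
  have hunit : (d * a ^ 2 + d' * b ^ 2 + 2 * a * b * Z : 𝓞 K) *
      (d * a ^ 2 + d' * b ^ 2 - 2 * a * b * Z) = 1 := by
    linear_combination (d * a ^ 2 - d' * b ^ 2 + 1 : 𝓞 K) * h' + 4 * a ^ 2 * b ^ 2 * hd'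
  refine ⟨d * a + b * Z, Associated.symm ⟨Units.mkOfMulEqOne _ _ hunit, ?_⟩⟩
  rw [Units.val_mkOfMulEqOne]
  linear_combination b ^ 2 * hd'

theorem isSquareUpToUnit_two_and_prime {p : ℕ} [Fact p.Prime] (hp : p % 4 = 3) {Z : 𝓞 K}
    (hZ : Z ^ 2 = ((2 * p : ℕ) : 𝓞 K)) : IsSquareUpToUnit K 2 ∧ IsSquareUpToUnit K p := by
  have hpP : p.Prime := Fact.out
  have hN := isSquareUpToUnit_of_sq_eq hZ
  have hns : ¬ IsSquare (2 * (p * 1)) :=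
    Nat.prime_two.not_isSquare_mul_of_not_dvd (by omega)
  obtain ⟨d, d', a, b, hdd, hd1, heq⟩ := exists_mul_sq_eq_mul_sq_add_one hns (Or.inr (by omega))
  have hd := isSquareUpToUnit_of_splitting hZ (by rw [hdd, mul_one]) heq
  obtain ⟨x2, d, d', rfl, rfl, hdd₁⟩ := exists_selectFactor Nat.prime_two hdd
  obtain ⟨xp, d, d', rfl, rfl, hdd₂⟩ := exists_selectFactor hpP hdd₁
  obtain ⟨rfl, rfl⟩ := mul_eq_one.mp hdd₂
  cases x2 <;> cases xp
  · exact absurd rfl hd1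
  · have hp' : IsSquareUpToUnit K p := by simpa [selectFactor] using hd
    exact ⟨hp'.of_mul_left (by rwa [mul_comm]) hpP.ne_zero, hp'⟩
  · have h2 : IsSquareUpToUnit K 2 := by simpa [selectFactor] using hd
    exact ⟨h2, h2.of_mul_left hN two_ne_zero⟩
  -- The choice $d=2p$, $d'=1$ would make $-1$ a square modulo $p\equiv 3\pmod 4$.
  · have := legendreSym_eq_one_of_dvd_left (ℓ := p) heq
      (dvd_mul_of_dvd_right (dvd_mul_right _ _) _)
    rw [legendreSym_neg_one_of_mod_four_eq_three hp] at this
    simp [selectFactor, boolSign, legendreSym.at_one] at this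

/-- If `u`, `v`, `w` are independent up to the squares given by two relations, each of them is a
square up to a unit. -/
theorem IsSquareUpToUnit.of_relations {u v w : ℕ} {xu xv xw yu yv yw : Bool}
    (hu : u ≠ 0) (hv : v ≠ 0) (hw : w ≠ 0) (h : IsSquareUpToUnit K (u * v * w))
    (hx : IsSquareUpToUnit K (selectFactor xu u * selectFactor xv v * selectFactor xw w))
    (hy : IsSquareUpToUnit K (selectFactor yu u * selectFactor yv v * selectFactor yw w))
    (hxuv : xu = xv) (hxw : xw ≠ xu) (hyuv : yu ≠ yv) :
    IsSquareUpToUnit K u ∧ IsSquareUpToUnit K v ∧ IsSquareUpToUnit K w := by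
  have hw' : IsSquareUpToUnit K w := by
    subst hxuv
    cases xu
    · obtain rfl : xw = true := by simpa using hxw
      simpa [selectFactor] using hx
    · obtain rfl : xw = false := by simpa using hxw
      have hx' : IsSquareUpToUnit K (u * v) := by simpa [selectFactor] using hx
      exact hx'.of_mul_left h (mul_ne_zero hu hv)
  have huv : IsSquareUpToUnit K (u * v) := hw'.of_mul_left (by rwa [mul_comm]) hw
  rw [mul_comm] at hy
  have hy' := hw'.of_selectFactor_mul hy hw
  cases yu
  · obtain rfl : yv = true := by simpa using hyuv.symm
    have hv' : IsSquareUpToUnit K v := by simpa [selectFactor] using hy'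
    exact ⟨hv'.of_mul_left (by rwa [mul_comm]) hv, hv', hw'⟩
  · obtain rfl : yv = false := by simpa using hyuv.symm
    have hu' : IsSquareUpToUnit K u := by simpa [selectFactor] using hy'
    exact ⟨hu', hu'.of_mul_left huv hu, hw'⟩

end SquareUpToUnit

/-! ### From squares up to units to the Pólya property -/

section Polya

theorem isPolyaField_of_isSquareUpToUnit {K : Type*} [Field K] [NumberField K] [IsGalois ℚ K]
    {p q r s : ℕ} (hp : p.Prime) (hq : q.Prime) (hr : r.Prime) (hs : s.Prime)
    (hp2 : p ≠ 2) (hq2 : q ≠ 2) (hr2 : r ≠ 2) (hs2 : s ≠ 2) (hpq : p ≠ q) (hpr : p ≠ r)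
    (hps : p ≠ s) (hqr : q ≠ r) (hqs : q ≠ s) (hrs : r ≠ s) (hmod : q * r * s % 4 = 1)
    (D : BiquadraticData K (2 * p) (q * r * s)) (h2 : IsSquareUpToUnit K 2)
    (hp' : IsSquareUpToUnit K p) (hq' : IsSquareUpToUnit K q) (hr' : IsSquareUpToUnit K r)
    (hs' : IsSquareUpToUnit K s) : IsPolyaField K := by
  have key : ∀ {ℓ a : ℕ}, ℓ.Prime → a.Prime → (ℓ ∣ a ↔ ℓ = a) :=
    fun hl ha => Nat.prime_dvd_prime_iff_eq hl ha
  have hp_odd : p % 2 = 1 := hp.eq_two_or_odd.resolve_left hp2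
  refine isPolyaField_of_radical_isPrincipal K fun ℓ hl => ?_
  suffices ∃ π, (Ideal.span {(ℓ : 𝓞 K)}).radical = Ideal.span {π} by
    obtain ⟨π, hπ⟩ := this
    exact ⟨⟨π, hπ⟩⟩
  by_cases e2 : ℓ = 2
  · subst e2
    obtain ⟨π, hπ⟩ := h2
    refine ⟨π, D.radical_span_two (by omega) ?_ hmod hπ⟩
    rw [Nat.squarefree_mul ((Nat.coprime_primes Nat.prime_two hp).mpr hp2.symm)]
    exact ⟨Nat.prime_two.squarefree, hp.squarefree⟩
  have hl2 : ¬ ℓ ∣ 2 := by rwa [key hl Nat.prime_two]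
  by_cases ep : ℓ = p
  · subst ep
    obtain ⟨π, hπ⟩ := hp'
    refine ⟨π, D.radical_span_of_dvd_left hl e2 ?_ (mul_comm _ _) hl2 hπ⟩
    simp [hl.dvd_mul, key hl, hq, hr, hs, hpq, hpr, hps]
  have hlp : ¬ ℓ ∣ 2 * p := by
    rw [hl.dvd_mul, key hl hp]
    tauto
  by_cases eq : ℓ = q
  · subst eq
    obtain ⟨π, hπ⟩ := hq'
    refine ⟨π, D.radical_span_of_dvd_right hl e2 hlp (mul_assoc _ _ _) ?_ hπ⟩
    simp [hl.dvd_mul, key hl, hr, hs, hqr, hqs]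
  by_cases er : ℓ = r
  · subst er
    obtain ⟨π, hπ⟩ := hr'
    refine ⟨π, D.radical_span_of_dvd_right hl e2 hlp (n' := q * s) (by ring) ?_ hπ⟩
    simp [hl.dvd_mul, key hl, hq, hs, hqr.symm, hrs]
  by_cases es : ℓ = s
  · subst es
    obtain ⟨π, hπ⟩ := hs'
    refine ⟨π, D.radical_span_of_dvd_right hl e2 hlp (mul_comm _ _) ?_ hπ⟩
    simp [hl.dvd_mul, key hl, hq, hr, hqs.symm, hrs.symm]
  · refine ⟨ℓ, D.radical_span_of_not_dvd hl e2 hlp ?_⟩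
    simp [hl.dvd_mul, key hl, hq, hr, hs, eq, er, es]

end Polya

/-! ### The main theorem -/

theorem theorem1p4 (p q r s : ℕ)
    [Fact p.Prime] [Fact q.Prime] [Fact r.Prime] [Fact s.Prime]
    (hp : p ≡ 3 [MOD 4]) (hq : q ≡ 3 [MOD 4]) (hr : r ≡ 3 [MOD 4])
    (hqrs : q * r * s ≡ 1 [MOD 4])
    (hexcl : ¬ (legendreSym s q = 1 ∧ legendreSym s r = 1))
    (hcond :
      -- part (i)
      ((legendreSym s q = -1 ∧ legendreSym s r = -1) ∧
        -- C1
        ((legendreSym s (2 * p) = -1 ∧ legendreSym p (q * r) = -1 ∧ legendreSym q (2 * p) = 1 ∧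
            ¬ q ≡ r [MOD 8]) ∨
        -- C2
          (legendreSym p s = 1 ∧ legendreSym p (q * r) = -1 ∧
            p ≡ q [MOD 8] ∧ q ≡ r [MOD 8] ∧ s ≡ 5 [MOD 8]) ∨
        -- C3
          (legendreSym p s = -1 ∧ legendreSym p (q * r) = -1 ∧
            ¬ p ≡ q [MOD 8] ∧ q ≡ r [MOD 8] ∧ s ≡ 1 [MOD 8]))) ∨
      -- part (ii)
      ((legendreSym s q ≠ legendreSym s r ∧ legendreSym s r = 1) ∧
        -- C4
        (((legendreSym p r = -1 ∧ legendreSym q p = -1 ∧ legendreSym r q = -1) ∧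
            ((legendreSym p 2 = -1 ∧ legendreSym r 2 = -1 ∧ legendreSym s 2 = -1 ∧
                legendreSym p s = 1) ∨
              (legendreSym p 2 = 1 ∧ legendreSym q 2 = 1 ∧ legendreSym r 2 = -1 ∧
                legendreSym s 2 = 1 ∧ legendreSym p s = -1))) ∨
        -- C5
          ((legendreSym p r = -1 ∧ legendreSym q p = -1 ∧ legendreSym q r = -1) ∧
            ((legendreSym p 2 = 1 ∧ legendreSym r 2 = -1 ∧ legendreSym s 2 = -1 ∧
                legendreSym p s = 1) ∨
              (legendreSym p 2 ≠ legendreSym q 2 ∧ legendreSym r 2 = -1 ∧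
                legendreSym s 2 = 1 ∧ legendreSym p s = -1))) ∨
        -- C6
          ((legendreSym r p = -1 ∧ legendreSym p q = -1 ∧ legendreSym q r = -1) ∧
            ((legendreSym p 2 = 1 ∧ legendreSym r 2 = 1 ∧ legendreSym s 2 = -1 ∧
                legendreSym p s = 1) ∨
              (legendreSym p 2 = -1 ∧ legendreSym q 2 = -1 ∧ legendreSym r 2 = 1 ∧
                legendreSym s 2 = 1 ∧ legendreSym p s = -1))) ∨
        -- C7
          ((legendreSym r p = -1 ∧ legendreSym p q = -1 ∧ legendreSym r q = -1) ∧
            ((legendreSym p 2 = -1 ∧ legendreSym r 2 = 1 ∧ legendreSym s 2 = -1 ∧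
                legendreSym p s = 1) ∨
              (legendreSym p 2 ≠ legendreSym q 2 ∧ legendreSym r 2 = 1 ∧
                legendreSym s 2 = 1 ∧ legendreSym p s = -1)))))) :
    IsPolyaField (realBiquadraticField (2 * p) (q * r * s)) := by
  have hpP : p.Prime := Fact.out
  have hqP : q.Prime := Fact.out
  have hrP : r.Prime := Fact.out
  have hsP : s.Prime := Fact.out
  have hp4 : p % 4 = 3 := hp
  have hq4 : q % 4 = 3 := hq
  have hr4 : r % 4 = 3 := hr
  have hn4 : q * r * s % 4 = 1 := hqrs
  have hs4 : s % 4 = 1 := by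
    have h1 : q * r % 4 = 1 := by simp [Nat.mul_mod, hq4, hr4]
    have h2 : q * r * s % 4 = s % 4 := by rw [Nat.mul_mod, h1, one_mul, Nat.mod_mod]
    omega
  have hps' : p ≠ s := by rintro rfl; omega
  have hqs' : q ≠ s := by rintro rfl; omega
  have hrs' : r ≠ s := by rintro rfl; omega
  -- Distinctness is implied by the symbols: $(a/a)=0$, and $(qr/p)=-1$ also excludes $q=r$, since
  -- then it would be a square.
  have hne : p ≠ q ∧ p ≠ r ∧ q ≠ r := by
    have hi : legendreSym p (q * r) = -1 → p ≠ q ∧ p ≠ r ∧ q ≠ r := by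
      intro h
      rw [legendreSym.mul] at h
      have hz : legendreSym p p = 0 := (legendreSym.eq_zero_iff p p).mpr (by simp)
      refine ⟨?_, ?_, ?_⟩ <;> rintro rfl
      · simp [hz] at h
      · simp [hz] at h
      · nlinarith
    have hii : ∀ {a b : ℕ} [Fact a.Prime], legendreSym a b = -1 → a ≠ b :=
      ne_of_legendreSym_eq_neg_one
    rcases hcond with ⟨-, h | h | h⟩ | ⟨-, h | h | h | h⟩
    · exact hi h.2.1
    · exact hi h.2.1
    · exact hi h.2.1
    · exact ⟨(hii h.1.2.1).symm, hii h.1.1, (hii h.1.2.2).symm⟩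
    · exact ⟨(hii h.1.2.1).symm, hii h.1.1, hii h.1.2.2⟩
    · exact ⟨hii h.1.2.1, (hii h.1.1).symm, hii h.1.2.2⟩
    · exact ⟨hii h.1.2.1, (hii h.1.1).symm, (hii h.1.2.2).symm⟩
  obtain ⟨hpq', hpr', hqr'⟩ := hne
  have hex : ∀ {a b : ℕ} [Fact a.Prime], b.Prime → a ≠ b → ∃ e, legendreSym a b = boolSign e :=
    fun {a b} _ hb hab => exists_legendreSym_eq_boolSign
      (by rwa [Nat.prime_dvd_prime_iff_eq Fact.out hb])
  obtain ⟨p2, hp2, hp8⟩ := exists_legendreSym_two_of_mod_four_eq_three hp4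
  obtain ⟨q2, hq2, hq8⟩ := exists_legendreSym_two_of_mod_four_eq_three hq4
  obtain ⟨r2, hr2, hr8⟩ := exists_legendreSym_two_of_mod_four_eq_three hr4
  obtain ⟨s2, hs2, hs8⟩ := exists_legendreSym_two_of_mod_four_eq_one hs4
  obtain ⟨pq, hpq⟩ := hex hqP hpq'
  obtain ⟨pr, hpr⟩ := hex hrP hpr'
  obtain ⟨qr, hqr⟩ := hex hrP hqr'
  obtain ⟨ps, hps⟩ := hex hsP hps'
  obtain ⟨qs, hqs⟩ := hex hsP hqs'
  obtain ⟨rs, hrs⟩ := hex hsP hrs'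
  have hqp : legendreSym q p = boolSign !pq := by
    rw [legendreSym.quadratic_reciprocity_three_mod_four hp4 hq4, hpq, neg_boolSign]
  have hrp : legendreSym r p = boolSign !pr := by
    rw [legendreSym.quadratic_reciprocity_three_mod_four hp4 hr4, hpr, neg_boolSign]
  have hrq : legendreSym r q = boolSign !qr := by
    rw [legendreSym.quadratic_reciprocity_three_mod_four hq4 hr4, hqr, neg_boolSign]
  have hsp : legendreSym s p = boolSign ps :=
    (legendreSym.quadratic_reciprocity_one_mod_four hs4 (by rintro rfl; omega)).symm.trans hps
  have hsq : legendreSym s q = boolSign qs :=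
    (legendreSym.quadratic_reciprocity_one_mod_four hs4 (by rintro rfl; omega)).symm.trans hqs
  have hsr : legendreSym s r = boolSign rs :=
    (legendreSym.quadratic_reciprocity_one_mod_four hs4 (by rintro rfl; omega)).symm.trans hrs
  have h8pq : p ≡ q [MOD 8] ↔ p2 = q2 := by
    rw [Bool.eq_iff_iff, hp8, hq8, Nat.ModEq]; omega
  have h8qr : q ≡ r [MOD 8] ↔ q2 = r2 := by
    rw [Bool.eq_iff_iff, hq8, hr8, Nat.ModEq]; omega
  have h8s5 : s ≡ 5 [MOD 8] ↔ s2 = true := by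
    rw [hs8, Nat.ModEq]
  have h8s1 : s ≡ 1 [MOD 8] ↔ s2 = false := by
    rw [← Bool.not_eq_true, hs8, Nat.ModEq]; omega
  simp only [legendreSym.mul, hp2, hq2, hr2, hs2, hpq, hqp, hpr, hrp, hqr, hrq, hps, hsp, hsq,
    hsr, boolSign_mul, boolSign_eq_one, boolSign_eq_neg_one, ne_eq, boolSign_inj, h8pq, h8qr,
    h8s5, h8s1] at hcond
  have hqs1 : qs = true := by
    rcases hcond with ⟨h, -⟩ | ⟨h, -⟩
    · exact h.1
    · rw [h.2] at h
      simpa using h.1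
  obtain ⟨xq, xr, xs, d', a, b, hd, heq, hx, hx'⟩ := exists_splitting_of_three_primes hq4 hr4 hs4
    hqr' hqs hsq hrs hsr hqr hrq hqs1
  obtain ⟨y2, yp, yq, yr, ys, e', a', b', he, heq', hy, hy'⟩ :=
    exists_splitting_of_five_primes hp4 hq4 hr4 hs4 hp2 hq2 hr2 hs2 hpq hqp hpr hrp hqr hrq hps hsp
      hqs hsq hrs hsr (selection_of_five_factors qs rs p2 q2 r2 s2 ps pq pr qr hcond)
  have hnsq : ¬ IsSquare (q * r * s) := by
    rw [mul_assoc]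
    refine hqP.not_isSquare_mul_of_not_dvd (hqP.not_dvd_prime_mul hrP hqr' ?_)
    rwa [Nat.prime_dvd_prime_iff_eq hqP hsP]
  have hodd : p * (q * r * s) % 2 = 1 := by
    have : p * (q * r * s) % 4 = 3 := by rw [Nat.mul_mod, hp4, hn4]
    omega
  obtain ⟨D⟩ := nonempty_biquadraticData (2 * p) (q * r * s)
    (Nat.prime_two.not_isSquare_mul_of_not_dvd (by omega)) hnsq
    (by rw [mul_assoc]; exact Nat.prime_two.not_isSquare_mul_of_not_dvd (by omega))
  obtain ⟨h2, hp'⟩ := isSquareUpToUnit_two_and_prime hp4 D.X_sq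
  have hn := isSquareUpToUnit_of_sq_eq D.Y_sq
  have hx3 := isSquareUpToUnit_of_splitting D.Y_sq hd heq
  have hXY : (D.X * D.Y) ^ 2 = ((2 * p * (q * r * s) : ℕ) :
      NumberField.RingOfIntegers (realBiquadraticField (2 * p) (q * r * s))) := by
    rw [mul_pow, D.X_sq, D.Y_sq, ← Nat.cast_mul]
  -- The factors 2 and $p$ are stripped from the relation given by $2pqrs$, leaving a relation among
  -- $q,r,s$.
  have hy3 := hp'.of_selectFactor_mul (h2.of_selectFactor_mul
    (isSquareUpToUnit_of_splitting hXY he heq') two_ne_zero) hpP.ne_zero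
  rw [← mul_assoc] at hx3 hy3
  have hall : IsSquareUpToUnit (realBiquadraticField (2 * p) (q * r * s)) q ∧
      IsSquareUpToUnit (realBiquadraticField (2 * p) (q * r * s)) r ∧
      IsSquareUpToUnit (realBiquadraticField (2 * p) (q * r * s)) s := by
    -- If $(r/s)=1$, the first relation singles out $r$ instead of $s$, so these two exchange their
    -- roles.
    cases rs
    · obtain ⟨h1, h3, h4⟩ := IsSquareUpToUnit.of_relations
        (K := realBiquadraticField (2 * p) (q * r * s)) (u := q) (v := s) (w := r)
        (xu := xq) (xv := xs) (xw := xr) (yu := yq) (yv := ys) (yw := yr)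
        hqP.ne_zero hsP.ne_zero hrP.ne_zero (by convert hn using 1; ring)
        (by convert hx3 using 1; ring) (by convert hy3 using 1; ring)
        (hx' rfl).1 (hx' rfl).2 (hy' rfl)
      exact ⟨h1, h4, h3⟩
    · exact IsSquareUpToUnit.of_relations hqP.ne_zero hrP.ne_zero hsP.ne_zero hn
        hx3 hy3 (hx rfl).1 (hx rfl).2 (hy rfl)
  exact isPolyaField_of_isSquareUpToUnit hpP hqP hrP hsP (by rintro rfl; omega)
    (by rintro rfl; omega) (by rintro rfl; omega) (by rintro rfl; omega) hpq' hpr' hps' hqr' hqs'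
    hrs' hn4 D h2 hp' hall.1 hall.2.1 hall.2.2
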